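/- Let $N>1$ and $d$ be integers and let $(C_1,\dots,C_N,Q)$ be a random element of $M(d\times d,\mathbb R)^N\times\mathbb R^d$. Let $C=C_I$ with $I$ uniform on $\{1,\dots,N\}$ and independent of $(C_1,\dots,C_N,Q)$, let $\Pi_n$ be the product of $n$ iid copies of $C$, and let $\|\cdot\|$ be the operator norm for the Euclidean norm $|\cdot|$. Put $s_\infty=\sup\{s>0:\mathbb E\|C\|^s<\infty\}\in[0,\infty]$ and, for $0<s<s_\infty$, $m(s)=N\lim_{n\to\infty}(\mathbb E\|\Pi_n\|^s)^{1/n}$. Let $\alpha=\inf\{s\in(0,s_\infty): m(s)\le 1\}$ and $\beta=\sup\{s\in(0,s_\infty): m(s)\le1\}\in[0,\infty]$. Assume $0<\alpha<\min\{s_\infty,2\}$, and that $\alpha<\beta$ with $m(s)<1$ for some $s\in(\alpha,\beta)$. If $\alpha\ge1$, let $r\in\mathbb R^d$ satisfy $r=N\,\mathbb E[Cr]+\mathbb E Q$. Assume $\mathbb E|Q|^s<\infty$ for some $\alpha<s<\min\{s_\infty,2\}$. A solution is a probability law $\mathcal L(R)$ on $\mathbb R^d$ such that $$R\overset{d}{=}\sum_{i=1}^N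 C_iR_i+Q,$$ where $R_1,\dots,R_N$ are iid with the law of $R$ and independent of $(C_1,\dots,C_N,Q)$. Then among the solutions with $\mathbb E|R|^t<\infty$ for some $t>\alpha$ and, in the case $\alpha\ge1$, with $\mathbb E R=r$, there is exactly one. If moreover $\mathbb E|Q|^{\min\{s_\infty,\beta\}}<\infty$ (read as $\mathbb E|Q|^t<\infty$ for all $t>0$ when the exponent is infinite), then this solution satisfies $\mathbb E|R|^s<\infty$ for all $0<s<\min\{s_\infty,\beta\}$. -/

import Mathlib

open MeasureTheory Filter
open scoped ENNReal

namespace SmoothingTransform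

/-- Euclidean space `ℝ^d`. -/
abbrev Vec (d : ℕ) : Type := EuclideanSpace ℝ (Fin d)

/-- The space of real `d × d` matrices. -/
abbrev Mat (d : ℕ) : Type := Matrix (Fin d) (Fin d) ℝ

/-- The Borel σ-algebra on matrices, that is, the product σ-algebra on the entries. -/
instance instMeasurableSpaceMat (d : ℕ) : MeasurableSpace (Mat d) :=
  inferInstanceAs (MeasurableSpace (Fin d → Fin d → ℝ))

instance instBorelSpaceMat (d : ℕ) : BorelSpace (Mat d) :=
  inferInstanceAs (BorelSpace (Fin d → Fin d → ℝ))

/-- The product `A x` of a matrix and a vector, as a vector of Euclidean space. -/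
noncomputable def act {d : ℕ} (A : Mat d) (x : Vec d) : Vec d :=
  WithLp.toLp 2 (A.mulVec x.ofLp)

/-- The operator norm `‖A‖ = sup {|A x| : |x| = 1}` with respect to the Euclidean norm,
as an extended nonnegative real. -/
noncomputable def opNorm {d : ℕ} (A : Mat d) : ℝ≥0∞ :=
  ‖Matrix.toEuclideanCLM (𝕜 := ℝ) A‖ₑ

/-- The smoothing transform: the law of `∑ i, C i (X i) + Q`, where `X 1, …, X N` are iid with
law `μ` and independent of `(C 1, …, C N, Q)`. -/
noncomputable def smoothing {Ω : Type*} [MeasurableSpace Ω] (P : Measure Ω) {N d : ℕ}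
    (C : Fin N → Ω → Mat d) (Q : Ω → Vec d) (μ : Measure (Vec d)) : Measure (Vec d) :=
  (P.prod (Measure.pi fun _ : Fin N => μ)).map
    fun p => ∑ i, act (C i p.1) (p.2 i) + Q p.1

/-- The law of the generic weight `C = C_I`, where the index `I` is uniformly distributed on
`{1, …, N}` and independent of `(C 1, …, C N)`. -/
noncomputable def weightLaw {Ω : Type*} [MeasurableSpace Ω] (P : Measure Ω) {N d : ℕ}
    (C : Fin N → Ω → Mat d) : Measure (Mat d) :=
  (N : ℝ≥0∞)⁻¹ • ∑ i, P.map (C i)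

/-- The law of the product `Π_n = C⁽¹⁾ ⋯ C⁽ⁿ⁾` of `n` iid matrices with law `ν`. -/
noncomputable def productLaw {d : ℕ} (ν : Measure (Mat d)) : ℕ → Measure (Mat d)
  | 0 => Measure.dirac 1
  | n + 1 => ((productLaw ν n).prod ν).map fun p => p.1 * p.2

/-- `E ‖A‖ ^ s` for a random matrix `A` with law `ν`. -/
noncomputable def normMoment {d : ℕ} (ν : Measure (Mat d)) (s : ℝ) : ℝ≥0∞ :=
  ∫⁻ A, opNorm A ^ s ∂ν

/-- `s_∞ = sup {s > 0 : E ‖C‖ ^ s < ∞}`, possibly infinite (and `0` if there is no such `s`). -/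
noncomputable def sInfty {d : ℕ} (ν : Measure (Mat d)) : ℝ≥0∞ :=
  sSup (ENNReal.ofReal '' {s : ℝ | 0 < s ∧ normMoment ν s < ∞})

/-- `m(s) = N lim_n (E ‖Π_n‖ ^ s) ^ (1 / n)`. For `0 < s < s_∞` the limit exists, since
`n ↦ E ‖Π_n‖ ^ s` is finite and submultiplicative, so that the upper limit is the limit. -/
noncomputable def mFun {d : ℕ} (N : ℕ) (ν : Measure (Mat d)) (s : ℝ) : ℝ≥0∞ :=
  (N : ℝ≥0∞) * limsup (fun n : ℕ => normMoment (productLaw ν n) s ^ (1 / (n : ℝ))) atTop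

/-- The set `{s > 0 : m(s) ≤ 1}`; the function `m` has domain `0 < s < s_∞`. -/
def subcritical {d : ℕ} (N : ℕ) (ν : Measure (Mat d)) : Set ℝ :=
  {s : ℝ | 0 < s ∧ ENNReal.ofReal s < sInfty ν ∧ mFun N ν s ≤ 1}

/-- `α = inf {s > 0 : m(s) ≤ 1}` (`∞` if the set is empty). -/
noncomputable def alphaExp {d : ℕ} (N : ℕ) (ν : Measure (Mat d)) : ℝ≥0∞ :=
  sInf (ENNReal.ofReal '' subcritical N ν)

/-- `β = sup {s > 0 : m(s) ≤ 1}`, possibly infinite (`0` if the set is empty). -/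
noncomputable def betaExp {d : ℕ} (N : ℕ) (ν : Measure (Mat d)) : ℝ≥0∞ :=
  sSup (ENNReal.ofReal '' subcritical N ν)

/-- A probability measure `μ` is (the law of) a solution of `R = ∑ i, C i (R i) + Q` in law if
it is a fixed point of the smoothing transform. -/
def IsSolution {Ω : Type*} [MeasurableSpace Ω] (P : Measure Ω) {N d : ℕ}
    (C : Fin N → Ω → Mat d) (Q : Ω → Vec d) (μ : Measure (Vec d)) : Prop :=
  IsProbabilityMeasure μ ∧ smoothing P C Q μ = μ

/-- The solutions among which uniqueness is claimed: `E |R| ^ t < ∞` for some `t > α`, and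
`E R = r` in the case `α ≥ 1`. -/
def IsAdmissibleSolution {Ω : Type*} [MeasurableSpace Ω] (P : Measure Ω) {N d : ℕ}
    (C : Fin N → Ω → Mat d) (Q : Ω → Vec d) (r : Vec d) (μ : Measure (Vec d)) : Prop :=
  IsSolution P C Q μ ∧
    (∃ t : ℝ, alphaExp N (weightLaw P C) < ENNReal.ofReal t ∧ ∫⁻ x, ‖x‖ₑ ^ t ∂μ < ∞) ∧
    (1 ≤ alphaExp N (weightLaw P C) → Integrable (fun x => x) μ ∧ ∫ x, x ∂μ = r)

end SmoothingTransform

open SmoothingTransform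

namespace SmoothingTransform

open scoped RealInnerProductSpace Topology

section Matrices

variable {d : ℕ}

lemma act_eq (A : Mat d) (x : Vec d) : act A x = Matrix.toEuclideanCLM (𝕜 := ℝ) A x := rfl

lemma act_sum {ι : Type*} (s : Finset ι) (A : Mat d) (x : ι → Vec d) :
    act A (∑ i ∈ s, x i) = ∑ i ∈ s, act A (x i) := by
  simp [act_eq]

lemma act_mul (A B : Mat d) (x : Vec d) : act (A * B) x = act A (act B x) := by
  simp [act_eq]

lemma act_one (x : Vec d) : act 1 x = x := by
  simp [act_eq]

lemma enorm_act_le (A : Mat d) (x : Vec d) : ‖act A x‖ₑ ≤ opNorm A * ‖x‖ₑ :=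
  ContinuousLinearMap.le_opENorm _ _

lemma opNorm_mul_le (A B : Mat d) : opNorm (A * B) ≤ opNorm A * opNorm B := by
  unfold opNorm
  rw [map_mul, ← ofReal_norm, ← ofReal_norm, ← ofReal_norm,
    ← ENNReal.ofReal_mul (norm_nonneg _)]
  exact ENNReal.ofReal_le_ofReal (norm_mul_le _ _)

lemma opNorm_one_le : opNorm (1 : Mat d) ≤ 1 := by
  unfold opNorm
  rw [map_one, ← ofReal_norm, ← ENNReal.ofReal_one]
  exact ENNReal.ofReal_le_ofReal ContinuousLinearMap.norm_id_le

lemma inner_act (A : Mat d) (x u : Vec d) : ⟪act A x, u⟫ = ⟪x, act A.transpose u⟫ := by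
  have h := ContinuousLinearMap.adjoint_inner_right (Matrix.toEuclideanCLM (𝕜 := ℝ) A) x u
  rw [← ContinuousLinearMap.star_eq_adjoint, ← map_star, Matrix.star_eq_conjTranspose,
    Matrix.conjTranspose_eq_transpose_of_trivial] at h
  exact h.symm

lemma opNorm_transpose (A : Mat d) : opNorm A.transpose = opNorm A := by
  unfold opNorm
  rw [← Matrix.conjTranspose_eq_transpose_of_trivial, ← Matrix.star_eq_conjTranspose, map_star,
    ← ofReal_norm, ← ofReal_norm, ContinuousLinearMap.star_eq_adjoint,
    LinearIsometryEquiv.norm_map]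

lemma continuous_act : Continuous fun p : Mat d × Vec d => act p.1 p.2 := by
  unfold act
  refine (PiLp.continuous_toLp 2 _).comp ?_
  exact Continuous.matrix_mulVec continuous_fst ((PiLp.continuous_ofLp 2 _).comp continuous_snd)

lemma measurable_act : Measurable fun p : Mat d × Vec d => act p.1 p.2 := by
  have : SecondCountableTopology (Mat d) :=
    inferInstanceAs (SecondCountableTopology (Fin d → Fin d → ℝ))
  exact continuous_act.measurable

lemma measurable_act' {α : Type*} [MeasurableSpace α] {f : α → Mat d} {g : α → Vec d}
    (hf : Measurable f) (hg : Measurable g) : Measurable fun a => act (f a) (g a) :=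
  measurable_act.comp (hf.prodMk hg)

lemma measurable_mul' : Measurable fun p : Mat d × Mat d => p.1 * p.2 := by
  have : SecondCountableTopology (Mat d) :=
    inferInstanceAs (SecondCountableTopology (Fin d → Fin d → ℝ))
  exact (Continuous.matrix_mul continuous_fst continuous_snd).measurable

lemma measurable_transpose : Measurable fun A : Mat d => A.transpose :=
  (Continuous.matrix_transpose continuous_id).measurable

lemma measurable_opNorm : Measurable (opNorm : Mat d → ℝ≥0∞) := by
  have h : Continuous (Matrix.toEuclideanCLM (n := Fin d) (𝕜 := ℝ)) :=
    LinearMap.continuous_of_finiteDimensional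
      (Matrix.toEuclideanCLM (n := Fin d) (𝕜 := ℝ)).toAlgEquiv.toLinearMap
  exact (continuous_enorm.comp h).measurable

end Matrices

section Laws

variable {Ω : Type*} [MeasurableSpace Ω] {P : Measure Ω} {N d : ℕ} {C : Fin N → Ω → Mat d}

lemma lintegral_weightLaw (hN : N ≠ 0) (hC : ∀ i, Measurable (C i)) {f : Mat d → ℝ≥0∞}
    (hf : Measurable f) :
    (N : ℝ≥0∞) * ∫⁻ A, f A ∂(weightLaw P C) = ∑ i, ∫⁻ ω, f (C i ω) ∂P := by
  have h0 : (N : ℝ≥0∞) ≠ 0 := by exact_mod_cast hN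
  rw [weightLaw, lintegral_smul_measure, smul_eq_mul, ← mul_assoc,
    ENNReal.mul_inv_cancel h0 (ENNReal.natCast_ne_top N), one_mul, lintegral_finsetSum_measure]
  exact Finset.sum_congr rfl fun i _ => lintegral_map hf (hC i)

lemma isProbabilityMeasure_weightLaw [IsProbabilityMeasure P] (hN : N ≠ 0)
    (hC : ∀ i, Measurable (C i)) : IsProbabilityMeasure (weightLaw P C) := by
  have h0 : (N : ℝ≥0∞) ≠ 0 := by exact_mod_cast hN
  constructor
  have h := lintegral_weightLaw (P := P) hN hC (f := fun _ => 1) measurable_const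
  simp only [lintegral_const, measure_univ, one_mul, Finset.sum_const, Finset.card_univ,
    Fintype.card_fin, nsmul_eq_mul, mul_one] at h
  have h' := congrArg (fun x => (N : ℝ≥0∞)⁻¹ * x) h
  simpa [← mul_assoc, ENNReal.inv_mul_cancel h0 (ENNReal.natCast_ne_top N)] using h'

lemma lintegral_productLaw_zero (ν : Measure (Mat d)) {f : Mat d → ℝ≥0∞} (hf : Measurable f) :
    ∫⁻ A, f A ∂(productLaw ν 0) = f 1 := by
  rw [productLaw, lintegral_dirac' _ hf]

variable {ν : Measure (Mat d)} [IsProbabilityMeasure ν]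

instance isProbabilityMeasure_productLaw (n : ℕ) : IsProbabilityMeasure (productLaw ν n) := by
  induction n with
  | zero => unfold productLaw; infer_instance
  | succ n ih =>
    unfold productLaw
    exact Measure.isProbabilityMeasure_map measurable_mul'.aemeasurable

lemma lintegral_productLaw_succ (n : ℕ) {f : Mat d → ℝ≥0∞} (hf : Measurable f) :
    ∫⁻ A, f A ∂(productLaw ν (n + 1)) = ∫⁻ A, ∫⁻ B, f (A * B) ∂ν ∂(productLaw ν n) := by
  rw [productLaw, lintegral_map hf measurable_mul',
    lintegral_prod (fun p : Mat d × Mat d => f (p.1 * p.2)) (hf.comp measurable_mul').aemeasurable]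

lemma normMoment_productLaw_le {t : ℝ} (ht : 0 ≤ t) (n : ℕ) :
    normMoment (productLaw ν n) t ≤ normMoment ν t ^ n := by
  induction n with
  | zero =>
    rw [normMoment, lintegral_productLaw_zero ν (measurable_opNorm.pow_const t), pow_zero]
    exact ENNReal.rpow_le_one opNorm_one_le ht
  | succ n ih =>
    rw [normMoment, lintegral_productLaw_succ n (measurable_opNorm.pow_const t), pow_succ]
    calc ∫⁻ A, ∫⁻ B, opNorm (A * B) ^ t ∂ν ∂(productLaw ν n)
        ≤ ∫⁻ A, ∫⁻ B, opNorm A ^ t * opNorm B ^ t ∂ν ∂(productLaw ν n) := by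
          gcongr with A B
          rw [← ENNReal.mul_rpow_of_nonneg _ _ ht]
          exact ENNReal.rpow_le_rpow (opNorm_mul_le A B) ht
      _ = normMoment (productLaw ν n) t * normMoment ν t := by
          simp_rw [lintegral_const_mul _ (measurable_opNorm.pow_const t)]
          rw [lintegral_mul_const _ (measurable_opNorm.pow_const t)]
          rfl
      _ ≤ _ := by gcongr

end Laws

section Moments

/-- For a probability measure, finiteness of a moment passes to smaller exponents. -/
lemma lintegral_rpow_le_one_add {α : Type*} [MeasurableSpace α] {μ : Measure α}
    [IsProbabilityMeasure μ] (f : α → ℝ≥0∞) {s t : ℝ} (hs : 0 ≤ s) (hst : s ≤ t) :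
    ∫⁻ x, f x ^ s ∂μ ≤ 1 + ∫⁻ x, f x ^ t ∂μ := by
  calc ∫⁻ x, f x ^ s ∂μ ≤ ∫⁻ x, (1 + f x ^ t) ∂μ := by
        gcongr with x
        rcases le_total (f x) 1 with h | h
        · exact (ENNReal.rpow_le_one h hs).trans le_self_add
        · exact (ENNReal.rpow_le_rpow_of_exponent_le h hst).trans le_add_self
    _ = _ := by
        rw [lintegral_add_left measurable_const]; simp

end Moments

section Growth

variable {N d : ℕ} {ν : Measure (Mat d)}

lemma eventually_moment_le_pow (hN : N ≠ 0) {s : ℝ} {c : ℝ≥0∞} (hc : mFun N ν s < c) :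
    ∀ᶠ n : ℕ in atTop, (N : ℝ≥0∞) ^ n * normMoment (productLaw ν n) s ≤ c ^ n := by
  have h0 : (N : ℝ≥0∞) ≠ 0 := by exact_mod_cast hN
  have hlim : limsup (fun n : ℕ => normMoment (productLaw ν n) s ^ (1 / (n : ℝ))) atTop
      < c / N := by
    rw [ENNReal.lt_div_iff_mul_lt (Or.inl h0) (Or.inl (ENNReal.natCast_ne_top N)), mul_comm]
    exact hc
  filter_upwards [eventually_lt_of_limsup_lt hlim, eventually_gt_atTop 0] with n hn hpos
  have hn' : normMoment (productLaw ν n) s ≤ (c / N) ^ n := by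
    have h := ENNReal.rpow_le_rpow hn.le (Nat.cast_nonneg n : (0 : ℝ) ≤ n)
    rwa [← ENNReal.rpow_mul, one_div, inv_mul_cancel₀ (by exact_mod_cast hpos.ne'),
      ENNReal.rpow_one, ENNReal.rpow_natCast] at h
  calc (N : ℝ≥0∞) ^ n * normMoment (productLaw ν n) s ≤ (N : ℝ≥0∞) ^ n * (c / N) ^ n := by gcongr
    _ = c ^ n := by
      rw [← mul_pow, ENNReal.mul_div_cancel h0 (ENNReal.natCast_ne_top N)]

lemma normMoment_interpolate (μ : Measure (Mat d)) {a b p q : ℝ} (ha : 0 ≤ a) (hb : 0 ≤ b)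
    (hp : 0 ≤ p) (hq : 0 ≤ q) (hpq : p + q = 1) :
    normMoment μ (a * p + b * q) ≤ normMoment μ a ^ p * normMoment μ b ^ q := by
  refine le_trans (le_of_eq ?_) (ENNReal.lintegral_mul_norm_pow_le
    (measurable_opNorm.pow_const a).aemeasurable (measurable_opNorm.pow_const b).aemeasurable
    hp hq hpq)
  refine lintegral_congr fun A => ?_
  rw [ENNReal.rpow_add_of_nonneg _ _ (mul_nonneg ha hp) (mul_nonneg hb hq), ENNReal.rpow_mul,
    ENNReal.rpow_mul]

/-- Log-convexity of `m`: strictly below one at one exponent and at most one at another forces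
geometric decay at every exponent in between. -/
lemma exists_geometric_bound (hN : N ≠ 0) {a b p q : ℝ} (ha : 0 ≤ a) (hb : 0 ≤ b)
    (hp : 0 < p) (hq : 0 ≤ q) (hpq : p + q = 1) (hma : mFun N ν a < 1) (hmb : mFun N ν b ≤ 1) :
    ∃ τ : ℝ≥0∞, τ < 1 ∧ ∀ᶠ n : ℕ in atTop,
      (N : ℝ≥0∞) ^ n * normMoment (productLaw ν n) (a * p + b * q) ≤ τ ^ n := by
  obtain ⟨ρ, hρ, hρ1⟩ := exists_between hma
  have hρp : ρ ^ p < 1 := ENNReal.rpow_lt_one hρ1 hp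
  have hcont : Tendsto (fun c : ℝ≥0∞ => ρ ^ p * c ^ q) (𝓝[>] 1) (𝓝 (ρ ^ p * 1 ^ q)) := by
    refine ENNReal.Tendsto.const_mul ?_ (Or.inr (hρp.trans ENNReal.one_lt_top).ne)
    exact (ENNReal.continuous_rpow_const.tendsto 1).mono_left nhdsWithin_le_nhds
  rw [ENNReal.one_rpow, mul_one] at hcont
  have : (𝓝[>] (1 : ℝ≥0∞)).NeBot := nhdsGT_neBot_of_exists_gt ⟨∞, ENNReal.one_lt_top⟩
  obtain ⟨c, hc, hc1⟩ := ((hcont.eventually_lt_const hρp).and self_mem_nhdsWithin).exists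
  refine ⟨_, hc, ?_⟩
  filter_upwards [eventually_moment_le_pow hN hρ,
    eventually_moment_le_pow hN (hmb.trans_lt hc1)] with n h1 h2
  calc (N : ℝ≥0∞) ^ n * normMoment (productLaw ν n) (a * p + b * q)
      ≤ ((N : ℝ≥0∞) ^ n) ^ p * ((N : ℝ≥0∞) ^ n) ^ q *
        (normMoment (productLaw ν n) a ^ p * normMoment (productLaw ν n) b ^ q) := by
        rw [← ENNReal.rpow_add_of_nonneg _ _ hp.le hq, hpq, ENNReal.rpow_one]
        gcongr
        exact normMoment_interpolate _ ha hb hp.le hq hpq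
    _ = ((N : ℝ≥0∞) ^ n * normMoment (productLaw ν n) a) ^ p *
        ((N : ℝ≥0∞) ^ n * normMoment (productLaw ν n) b) ^ q := by
        rw [ENNReal.mul_rpow_of_nonneg _ _ hp.le, ENNReal.mul_rpow_of_nonneg _ _ hq]
        ring
    _ ≤ (ρ ^ n) ^ p * (c ^ n) ^ q := by gcongr
    _ = (ρ ^ p * c ^ q) ^ n := by
        rw [mul_pow]
        simp_rw [← ENNReal.rpow_natCast, ← ENNReal.rpow_mul]
        rw [mul_comm p, mul_comm q]

lemma tsum_ne_top_of_eventually_le_pow {a : ℕ → ℝ≥0∞} (ha : ∀ n, a n ≠ ∞) {τ : ℝ≥0∞}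
    (hτ : τ < 1) (h : ∀ᶠ n in atTop, a n ≤ τ ^ n) : ∑' n, a n ≠ ∞ := by
  obtain ⟨n₀, hn₀⟩ := eventually_atTop.1 h
  rw [← (ENNReal.summable (f := fun n => a (n + n₀))).sum_add_tsum_nat_add']
  refine ENNReal.add_ne_top.2 ⟨ENNReal.sum_ne_top.2 fun n _ => ha n, ne_top_of_le_ne_top ?_
    ((ENNReal.tsum_le_tsum fun n => hn₀ (n + n₀) (Nat.le_add_left _ _)).trans
      (ENNReal.tsum_comp_le_tsum_of_injective (add_left_injective n₀) fun n => τ ^ n))⟩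
  rw [ENNReal.tsum_geometric]
  exact ENNReal.inv_ne_top.2 (tsub_pos_of_lt hτ).ne'

lemma normMoment_ne_top [IsProbabilityMeasure ν] {t : ℝ} (ht : 0 ≤ t) (h : ENNReal.ofReal t < sInfty ν) :
    normMoment ν t ≠ ∞ := by
  obtain ⟨_, ⟨s, ⟨hs0, hs⟩, rfl⟩, hts⟩ := lt_sSup_iff.1 h
  have hts' : t ≤ s := ((ENNReal.ofReal_lt_ofReal_iff hs0).1 hts).le
  refine ne_top_of_le_ne_top ?_ (lintegral_rpow_le_one_add opNorm ht hts')
  exact ENNReal.add_ne_top.2 ⟨ENNReal.one_ne_top, hs.ne⟩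

lemma betaExp_le_sInfty : betaExp N ν ≤ sInfty ν := by
  refine sSup_le ?_
  rintro _ ⟨s, hs, rfl⟩
  exact hs.2.1.le

/-- Between `α` and `β` the total moments of the generations of the branching tree are summable. -/
lemma tsum_moment_ne_top [IsProbabilityMeasure ν] (hN : N ≠ 0)
    (hm : ∃ s : ℝ, alphaExp N ν < ENNReal.ofReal s ∧
      ENNReal.ofReal s < betaExp N ν ∧ mFun N ν s < 1) {t : ℝ}
    (h1 : alphaExp N ν < ENNReal.ofReal t) (h2 : ENNReal.ofReal t < betaExp N ν) :
    ∑' n, (N : ℝ≥0∞) ^ n * normMoment (productLaw ν n) t ≠ ∞ := by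
  have ht : 0 < t := ENNReal.ofReal_pos.1 (bot_le.trans_lt h1)
  obtain ⟨s, hs1, hs2, hs⟩ := hm
  have hs0 : 0 < s := ENNReal.ofReal_pos.1 (bot_le.trans_lt hs1)
  have hfin : ∀ n, (N : ℝ≥0∞) ^ n * normMoment (productLaw ν n) t ≠ ∞ := fun n =>
    ENNReal.mul_ne_top (ENNReal.pow_ne_top (ENNReal.natCast_ne_top N))
      (ne_top_of_le_ne_top (ENNReal.pow_ne_top
        (normMoment_ne_top ht.le (h2.trans_le betaExp_le_sInfty)))
        (normMoment_productLaw_le ht.le n))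
  obtain ⟨b, hb0, hbm, p, q, hp, hq, hpq, rfl⟩ : ∃ b : ℝ, 0 ≤ b ∧ mFun N ν b ≤ 1 ∧
      ∃ p q : ℝ, 0 < p ∧ 0 ≤ q ∧ p + q = 1 ∧ s * p + b * q = t := by
    rcases le_total t s with hts | hts
    · obtain ⟨_, ⟨b, hb, rfl⟩, hbt⟩ := sInf_lt_iff.1 h1
      have hbt' : b < t := (ENNReal.ofReal_lt_ofReal_iff ht).1 hbt
      have hsb : 0 < s - b := by linarith
      refine ⟨b, hb.1.le, hb.2.2, (t - b) / (s - b), (s - t) / (s - b),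
        div_pos (by linarith) hsb, div_nonneg (by linarith) hsb.le, ?_, ?_⟩ <;> field_simp <;> ring
    · obtain ⟨_, ⟨b, hb, rfl⟩, hbt⟩ := lt_sSup_iff.1 h2
      have hbt' : t < b := (ENNReal.ofReal_lt_ofReal_iff hb.1).1 hbt
      have hsb : 0 < b - s := by linarith
      refine ⟨b, hb.1.le, hb.2.2, (b - t) / (b - s), (t - s) / (b - s),
        div_pos (by linarith) hsb, div_nonneg (by linarith) hsb.le, ?_, ?_⟩ <;> field_simp <;> ring
  obtain ⟨τ, hτ, hev⟩ := exists_geometric_bound hN hs0.le hb0 hp hq hpq hs hbm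
  exact tsum_ne_top_of_eventually_le_pow hfin hτ hev

end Growth

section Fourier

variable {Ω : Type*} [MeasurableSpace Ω] {P : Measure Ω} [IsProbabilityMeasure P] {N d : ℕ}
  {C : Fin N → Ω → Mat d} {Q : Ω → Vec d}

lemma measurable_smoothing_map (hC : ∀ i, Measurable (C i)) (hQ : Measurable Q) :
    Measurable fun p : Ω × (Fin N → Vec d) => ∑ i, act (C i p.1) (p.2 i) + Q p.1 := by
  refine Measurable.add (Finset.measurable_sum _ fun i _ => ?_) (hQ.comp measurable_fst)
  exact measurable_act' ((hC i).comp measurable_fst)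
    ((measurable_pi_apply i).comp measurable_snd)

lemma isProbabilityMeasure_smoothing (hC : ∀ i, Measurable (C i)) (hQ : Measurable Q)
    (μ : Measure (Vec d)) [IsProbabilityMeasure μ] :
    IsProbabilityMeasure (smoothing P C Q μ) :=
  Measure.isProbabilityMeasure_map (measurable_smoothing_map hC hQ).aemeasurable

lemma isProbabilityMeasure_iterate (hC : ∀ i, Measurable (C i)) (hQ : Measurable Q)
    (μ : Measure (Vec d)) [IsProbabilityMeasure μ] (n : ℕ) :
    IsProbabilityMeasure ((smoothing P C Q)^[n] μ) := by
  induction n with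
  | zero => simpa
  | succ n ih =>
    rw [Function.iterate_succ_apply']
    exact isProbabilityMeasure_smoothing hC hQ _

lemma charFun_smoothing (hC : ∀ i, Measurable (C i)) (hQ : Measurable Q)
    (μ : Measure (Vec d)) [IsProbabilityMeasure μ] (u : Vec d) :
    charFun (smoothing P C Q μ) u =
      ∫ ω, (∏ i, charFun μ (act (C i ω).transpose u)) * Complex.exp (⟪Q ω, u⟫ * Complex.I) ∂P := by
  have hm := measurable_smoothing_map hC hQ
  have hexp : Measurable fun x : Vec d => Complex.exp (⟪x, u⟫ * Complex.I) := by fun_prop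
  rw [charFun_apply, smoothing, integral_map hm.aemeasurable hexp.aestronglyMeasurable,
    integral_prod]
  · refine integral_congr_ae (Eventually.of_forall fun ω => ?_)
    have hprod : ∀ x : Fin N → Vec d,
        Complex.exp (⟪∑ i, act (C i ω) (x i) + Q ω, u⟫ * Complex.I) =
          (∏ i, Complex.exp (⟪x i, act (C i ω).transpose u⟫ * Complex.I)) *
            Complex.exp (⟪Q ω, u⟫ * Complex.I) := by
      intro x
      rw [← Complex.exp_sum, ← Complex.exp_add, inner_add_left, sum_inner]
      simp_rw [inner_act]
      push_cast
      rw [add_mul, Finset.sum_mul]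
    simp only [hprod]
    rw [integral_mul_const, integral_fintype_prod_eq_prod (μ := fun _ : Fin N => μ)
      (f := fun i x => Complex.exp (⟪x, act (C i ω).transpose u⟫ * Complex.I))]
    rfl
  · refine Integrable.of_bound (hexp.comp hm).aestronglyMeasurable 1
      (Eventually.of_forall fun p => ?_)
    simp [Complex.norm_exp_ofReal_mul_I]

lemma enorm_prod_sub_prod_le {ι : Type*} (s : Finset ι) {a b : ι → ℂ} (ha : ∀ i, ‖a i‖ ≤ 1)
    (hb : ∀ i, ‖b i‖ ≤ 1) : ‖∏ i ∈ s, a i - ∏ i ∈ s, b i‖ₑ ≤ ∑ i ∈ s, ‖a i - b i‖ₑ := by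
  classical
  have one {z : ℂ} (hz : ‖z‖ ≤ 1) : ‖z‖ₑ ≤ 1 := by
    rw [← ofReal_norm, ← ENNReal.ofReal_one]
    exact ENNReal.ofReal_le_ofReal hz
  induction s using Finset.induction_on with
  | empty => simp
  | insert j s hj ih =>
    rw [Finset.prod_insert hj, Finset.prod_insert hj, Finset.sum_insert hj]
    have hbs : ‖∏ i ∈ s, b i‖ ≤ 1 := by
      rw [norm_prod]
      exact Finset.prod_le_one (fun i _ => norm_nonneg _) fun i _ => hb i
    calc ‖a j * ∏ i ∈ s, a i - b j * ∏ i ∈ s, b i‖ₑ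
        = ‖a j * (∏ i ∈ s, a i - ∏ i ∈ s, b i) + (a j - b j) * ∏ i ∈ s, b i‖ₑ := by ring_nf
      _ ≤ ‖a j‖ₑ * ‖∏ i ∈ s, a i - ∏ i ∈ s, b i‖ₑ + ‖a j - b j‖ₑ * ‖∏ i ∈ s, b i‖ₑ := by
          refine (enorm_add_le _ _).trans ?_
          rw [enorm_mul, enorm_mul]
      _ ≤ 1 * ∑ i ∈ s, ‖a i - b i‖ₑ + ‖a j - b j‖ₑ * 1 := by
          gcongr
          · exact one (ha j)
          · exact one hbs
      _ = _ := by rw [one_mul, mul_one, add_comm]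

lemma measurable_enorm_charFun_sub (μ μ' : Measure (Vec d)) [IsProbabilityMeasure μ]
    [IsProbabilityMeasure μ'] (u : Vec d) :
    Measurable fun A : Mat d =>
      ‖charFun μ (act A.transpose u) - charFun μ' (act A.transpose u)‖ₑ := by
  have h : Measurable fun A : Mat d => act A.transpose u :=
    measurable_act' measurable_transpose measurable_const
  exact ((measurable_charFun.comp h).sub (measurable_charFun.comp h)).enorm

/-- The smoothing transform contracts the Fourier distance in mean. -/
lemma enorm_charFun_smoothing_sub_le (hN : N ≠ 0) (hC : ∀ i, Measurable (C i)) (hQ : Measurable Q)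
    (μ μ' : Measure (Vec d)) [IsProbabilityMeasure μ] [IsProbabilityMeasure μ'] (u : Vec d) :
    ‖charFun (smoothing P C Q μ) u - charFun (smoothing P C Q μ') u‖ₑ ≤
      N * ∫⁻ A, ‖charFun μ (act A.transpose u) - charFun μ' (act A.transpose u)‖ₑ
        ∂(weightLaw P C) := by
  have hint : ∀ (κ : Measure (Vec d)) [IsProbabilityMeasure κ], Integrable (fun ω =>
      (∏ i, charFun κ (act (C i ω).transpose u)) * Complex.exp (⟪Q ω, u⟫ * Complex.I)) P := by
    intro κ _
    refine Integrable.of_bound (Measurable.aestronglyMeasurable ?_) 1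
      (Eventually.of_forall fun ω => ?_)
    · refine Measurable.mul (Finset.measurable_prod _ fun i _ => measurable_charFun.comp ?_)
        (by fun_prop)
      exact measurable_act' (measurable_transpose.comp (hC i)) measurable_const
    · rw [norm_mul, Complex.norm_exp_ofReal_mul_I, mul_one, norm_prod]
      exact Finset.prod_le_one (fun i _ => norm_nonneg _) fun i _ => norm_charFun_le_one _
  rw [charFun_smoothing hC hQ, charFun_smoothing hC hQ, ← integral_sub (hint μ) (hint μ'),
    lintegral_weightLaw hN hC (measurable_enorm_charFun_sub μ μ' u), ← lintegral_finsetSum]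
  · refine (enorm_integral_le_lintegral_enorm _).trans (lintegral_mono fun ω => ?_)
    have h1 : ‖Complex.exp (⟪Q ω, u⟫ * Complex.I)‖ₑ = 1 := by
      rw [← ofReal_norm, Complex.norm_exp_ofReal_mul_I, ENNReal.ofReal_one]
    rw [← sub_mul, enorm_mul, h1, mul_one]
    exact enorm_prod_sub_prod_le _ (fun i => norm_charFun_le_one _) fun i => norm_charFun_le_one _
  · exact fun i _ => (measurable_enorm_charFun_sub μ μ' u).comp (hC i)

lemma enorm_charFun_iterate_sub_le (hN : N ≠ 0) (hC : ∀ i, Measurable (C i)) (hQ : Measurable Q)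
    (n : ℕ) (μ μ' : Measure (Vec d)) [IsProbabilityMeasure μ] [IsProbabilityMeasure μ']
    (u : Vec d) :
    ‖charFun ((smoothing P C Q)^[n] μ) u - charFun ((smoothing P C Q)^[n] μ') u‖ₑ ≤
      (N : ℝ≥0∞) ^ n *
        ∫⁻ A, ‖charFun μ (act A.transpose u) - charFun μ' (act A.transpose u)‖ₑ
          ∂(productLaw (weightLaw P C) n) := by
  have := isProbabilityMeasure_weightLaw (P := P) hN hC
  induction n generalizing μ μ' with
  | zero =>
    rw [lintegral_productLaw_zero _ (measurable_enorm_charFun_sub μ μ' u)]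
    simp [act_one]
  | succ n ih =>
    have := isProbabilityMeasure_smoothing (P := P) hC hQ μ
    have := isProbabilityMeasure_smoothing (P := P) hC hQ μ'
    rw [Function.iterate_succ_apply, Function.iterate_succ_apply,
      lintegral_productLaw_succ n (measurable_enorm_charFun_sub μ μ' u)]
    calc _ ≤ _ := ih (smoothing P C Q μ) (smoothing P C Q μ')
      _ ≤ (N : ℝ≥0∞) ^ n * ∫⁻ A, N * ∫⁻ B,
          ‖charFun μ (act (A * B).transpose u) - charFun μ' (act (A * B).transpose u)‖ₑ
            ∂(weightLaw P C) ∂(productLaw (weightLaw P C) n) := by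
          gcongr with A
          refine (enorm_charFun_smoothing_sub_le hN hC hQ μ μ' _).trans (le_of_eq ?_)
          simp_rw [Matrix.transpose_mul, act_mul]
      _ = _ := by
          rw [lintegral_const_mul' _ _ (ENNReal.natCast_ne_top N), pow_succ, mul_assoc]

/-- Fourier distance of order `s` decays along the iteration like the moments of the products. -/
lemma enorm_charFun_iterate_sub_le_of_le (hN : N ≠ 0) (hC : ∀ i, Measurable (C i))
    (hQ : Measurable Q) {μ μ' : Measure (Vec d)} [IsProbabilityMeasure μ]
    [IsProbabilityMeasure μ'] {s : ℝ} (hs : 0 ≤ s) {K : ℝ≥0∞}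
    (h : ∀ u, ‖charFun μ u - charFun μ' u‖ₑ ≤ K * ‖u‖ₑ ^ s) (n : ℕ) (u : Vec d) :
    ‖charFun ((smoothing P C Q)^[n] μ) u - charFun ((smoothing P C Q)^[n] μ') u‖ₑ ≤
      (N : ℝ≥0∞) ^ n * normMoment (productLaw (weightLaw P C) n) s * (K * ‖u‖ₑ ^ s) := by
  refine (enorm_charFun_iterate_sub_le hN hC hQ n μ μ' u).trans ?_
  rw [mul_assoc]
  gcongr
  rw [normMoment, ← lintegral_mul_const _ (measurable_opNorm.pow_const s)]
  gcongr with A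
  calc _ ≤ K * ‖act A.transpose u‖ₑ ^ s := h _
    _ ≤ K * (opNorm A * ‖u‖ₑ) ^ s := by
        gcongr
        rw [← opNorm_transpose A]
        exact enorm_act_le _ _
    _ = _ := by rw [ENNReal.mul_rpow_of_nonneg _ _ hs]; ring

end Fourier

section Expansion

variable {d : ℕ}

lemma enorm_exp_sub_one_le {s : ℝ} (h0 : 0 < s) (h1 : s ≤ 1) (x : ℝ) :
    ‖Complex.exp (x * Complex.I) - 1‖ₑ ≤ 2 * ‖x‖ₑ ^ s := by
  have key : ‖Complex.exp (x * Complex.I) - 1‖ ≤ 2 * |x| ^ s := by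
    rcases le_total |x| 1 with h | h
    · have h' : |x| ≤ |x| ^ s := by
        simpa using Real.rpow_le_rpow_of_exponent_ge_of_imp (abs_nonneg x) h h1
          (fun _ => by simp [h0.ne'])
      have := Real.norm_exp_I_mul_ofReal_sub_one_le (x := x)
      rw [mul_comm, Real.norm_eq_abs] at this
      linarith [Real.rpow_nonneg (abs_nonneg x) s]
    · have h' : 1 ≤ |x| ^ s := Real.one_le_rpow h h0.le
      have := norm_sub_le (Complex.exp (x * Complex.I)) 1
      rw [Complex.norm_exp_ofReal_mul_I, norm_one] at this
      linarith
  calc _ = ENNReal.ofReal ‖Complex.exp (x * Complex.I) - 1‖ := (ofReal_norm _).symm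
    _ ≤ ENNReal.ofReal (2 * |x| ^ s) := ENNReal.ofReal_le_ofReal key
    _ = _ := by
      rw [ENNReal.ofReal_mul zero_le_two, ← ENNReal.ofReal_rpow_of_nonneg (abs_nonneg x) h0.le,
        ← Real.norm_eq_abs, ofReal_norm]
      simp

lemma enorm_exp_sub_one_sub_le {s : ℝ} (h1 : 1 ≤ s) (h2 : s ≤ 2) (x : ℝ) :
    ‖Complex.exp (x * Complex.I) - 1 - x * Complex.I‖ₑ ≤ 3 * ‖x‖ₑ ^ s := by
  have h0 : 0 < s := by linarith
  have key : ‖Complex.exp (x * Complex.I) - 1 - x * Complex.I‖ ≤ 3 * |x| ^ s := by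
    rcases le_total |x| 1 with h | h
    · have h' : |x| ^ 2 ≤ |x| ^ s := by
        simpa using Real.rpow_le_rpow_of_exponent_ge_of_imp (abs_nonneg x) h h2
          (fun _ => by simp [h0.ne'])
      have := Complex.norm_exp_sub_one_sub_id_le (x := x * Complex.I) (by simpa using h)
      simp only [norm_mul, Complex.norm_real, Complex.norm_I, mul_one, Real.norm_eq_abs] at this
      linarith [Real.rpow_nonneg (abs_nonneg x) s]
    · have h' : 1 ≤ |x| ^ s := Real.one_le_rpow h h0.le
      have h'' : |x| ≤ |x| ^ s := by
        simpa using Real.rpow_le_rpow_of_exponent_le h h1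
      have a := norm_sub_le (Complex.exp (x * Complex.I)) 1
      have b := norm_sub_le (Complex.exp (x * Complex.I) - 1) (x * Complex.I)
      rw [Complex.norm_exp_ofReal_mul_I, norm_one] at a
      simp only [norm_mul, Complex.norm_real, Complex.norm_I, mul_one, Real.norm_eq_abs] at b
      linarith
  calc _ = ENNReal.ofReal ‖Complex.exp (x * Complex.I) - 1 - x * Complex.I‖ := (ofReal_norm _).symm
    _ ≤ ENNReal.ofReal (3 * |x| ^ s) := ENNReal.ofReal_le_ofReal key
    _ = _ := by
      rw [ENNReal.ofReal_mul (by norm_num), ← ENNReal.ofReal_rpow_of_nonneg (abs_nonneg x) h0.le,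
        ← Real.norm_eq_abs, ofReal_norm]
      simp

lemma enorm_charFun_sub_expansion_le {s : ℝ} (hs : 0 ≤ s) {c : ℂ} {κ : ℝ≥0∞}
    (h : ∀ x : ℝ, ‖Complex.exp (x * Complex.I) - 1 - c * (x * Complex.I)‖ₑ ≤ κ * ‖x‖ₑ ^ s)
    {μ : Measure (Vec d)} [IsProbabilityMeasure μ] {m : Vec d}
    (hm : c = 0 ∨ Integrable (fun x => x) μ ∧ ∫ x, x ∂μ = m) (u : Vec d) :
    ‖charFun μ u - 1 - c * (⟪m, u⟫ * Complex.I)‖ₑ ≤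
      (κ * ∫⁻ x, ‖x‖ₑ ^ s ∂μ) * ‖u‖ₑ ^ s := by
  have hexp : Integrable (fun x : Vec d => Complex.exp (⟪x, u⟫ * Complex.I)) μ :=
    Integrable.of_bound (by fun_prop) 1
      (Eventually.of_forall fun p => by simp [Complex.norm_exp_ofReal_mul_I])
  have hlin : Integrable (fun x : Vec d => c * ((⟪x, u⟫ : ℂ) * Complex.I)) μ ∧
      ∫ x : Vec d, c * ((⟪x, u⟫ : ℂ) * Complex.I) ∂μ = c * (⟪m, u⟫ * Complex.I) := by
    rcases hm with rfl | ⟨hi, hm⟩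
    · simp
    · have hi' : Integrable (fun x : Vec d => ⟪x, u⟫) μ := hi.inner_const u
      refine ⟨(hi'.ofReal.mul_const _).const_mul _, ?_⟩
      rw [integral_const_mul, integral_mul_const, integral_complex_ofReal]
      simp_rw [real_inner_comm u]
      rw [integral_inner hi, hm]
  have heq : charFun μ u - 1 - c * (⟪m, u⟫ * Complex.I) =
      ∫ x : Vec d, (Complex.exp (⟪x, u⟫ * Complex.I) - 1 - c * (⟪x, u⟫ * Complex.I)) ∂μ := by
    have hexp' : Integrable (fun x : Vec d => Complex.exp (⟪x, u⟫ * Complex.I) - 1) μ :=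
      hexp.sub (integrable_const 1)
    rw [integral_sub hexp' hlin.1, integral_sub hexp
      (integrable_const 1), hlin.2, charFun_apply]
    simp
  rw [heq]
  refine (enorm_integral_le_lintegral_enorm _).trans ?_
  have hmeas : Measurable fun x : Vec d => ‖x‖ₑ ^ s := measurable_enorm.pow_const s
  rw [mul_assoc, ← lintegral_mul_const _ hmeas, ← lintegral_const_mul _ (hmeas.mul_const _)]
  refine lintegral_mono fun x => (h _).trans ?_
  rw [← ENNReal.mul_rpow_of_nonneg _ _ hs]
  gcongr
  rw [← ofReal_norm, ← ofReal_norm, ← ofReal_norm, ← ENNReal.ofReal_mul (norm_nonneg _)]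
  exact ENNReal.ofReal_le_ofReal (norm_inner_le_norm x u)

/-- A law with finite moment of order `s ≤ 2` and, if `s > 1`, with mean `m`, is at finite Fourier
distance of order `s` from the point mass at `m`. -/
lemma exists_enorm_charFun_sub_dirac_le {s : ℝ} (h0 : 0 < s) (h2 : s ≤ 2)
    {μ : Measure (Vec d)} [IsProbabilityMeasure μ] (hμ : ∫⁻ x, ‖x‖ₑ ^ s ∂μ < ∞) {m : Vec d}
    (hm : 1 < s → Integrable (fun x => x) μ ∧ ∫ x, x ∂μ = m) :
    ∃ K : ℝ≥0∞, K ≠ ∞ ∧ ∀ u, ‖charFun μ u - charFun (Measure.dirac m) u‖ₑ ≤ K * ‖u‖ₑ ^ s := by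
  obtain ⟨c, κ, hκ, h, hc⟩ : ∃ (c : ℂ) (κ : ℝ≥0∞), κ ≠ ∞ ∧
      (∀ x : ℝ, ‖Complex.exp (x * Complex.I) - 1 - c * (x * Complex.I)‖ₑ ≤ κ * ‖x‖ₑ ^ s) ∧
      (c = 0 ∨ 1 < s) := by
    rcases le_or_gt s 1 with h1 | h1
    · exact ⟨0, 2, by simp, fun x => by simpa using enorm_exp_sub_one_le h0 h1 x, Or.inl rfl⟩
    · exact ⟨1, 3, by simp, fun x => by simpa using enorm_exp_sub_one_sub_le h1.le h2 x,
        Or.inr h1⟩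
  have hδ : Integrable (fun x : Vec d => x) (Measure.dirac m) ∧
      ∫ x : Vec d, x ∂(Measure.dirac m) = m := ⟨integrable_dirac (by simp), integral_dirac _ _⟩
  have hδs : ∫⁻ x : Vec d, ‖x‖ₑ ^ s ∂(Measure.dirac m) ≠ ∞ := by
    rw [lintegral_dirac' _ (measurable_enorm.pow_const s)]
    exact ENNReal.rpow_ne_top_of_nonneg h0.le enorm_ne_top
  refine ⟨(κ * ∫⁻ x, ‖x‖ₑ ^ s ∂μ) + κ * ∫⁻ x, ‖x‖ₑ ^ s ∂(Measure.dirac m),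
    ENNReal.add_ne_top.2 ⟨ENNReal.mul_ne_top hκ hμ.ne, ENNReal.mul_ne_top hκ hδs⟩, fun u => ?_⟩
  rw [add_mul]
  calc _ = ‖(charFun μ u - 1 - c * (⟪m, u⟫ * Complex.I)) -
        (charFun (Measure.dirac m) u - 1 - c * (⟪m, u⟫ * Complex.I))‖ₑ := by
        congr 1; ring
    _ ≤ _ := (enorm_sub_le).trans (add_le_add
        (enorm_charFun_sub_expansion_le h0.le h (hc.imp_right hm) u)
        (enorm_charFun_sub_expansion_le h0.le h (hc.imp_right fun _ => hδ) u))

end Expansion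

section FixedPoint

variable {Ω : Type*} [MeasurableSpace Ω] {P : Measure Ω} [IsProbabilityMeasure P] {N d : ℕ}
  {C : Fin N → Ω → Mat d} {Q : Ω → Vec d}

/-- Two fixed points at finite Fourier distance of order `s` coincide. -/
lemma eq_of_isFixedPt (hN : N ≠ 0) (hC : ∀ i, Measurable (C i)) (hQ : Measurable Q)
    {μ μ' : Measure (Vec d)} [IsProbabilityMeasure μ] [IsProbabilityMeasure μ']
    (hμ : smoothing P C Q μ = μ) (hμ' : smoothing P C Q μ' = μ') {s : ℝ} (hs : 0 ≤ s)
    (hsum : ∑' n, (N : ℝ≥0∞) ^ n * normMoment (productLaw (weightLaw P C) n) s ≠ ∞)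
    {K : ℝ≥0∞} (hK : K ≠ ∞) (h : ∀ u, ‖charFun μ u - charFun μ' u‖ₑ ≤ K * ‖u‖ₑ ^ s) : μ = μ' := by
  refine Measure.ext_of_charFun (funext fun u => ?_)
  have hle := fun n => enorm_charFun_iterate_sub_le_of_le (P := P) hN hC hQ hs h n u
  simp only [Function.iterate_fixed hμ, Function.iterate_fixed hμ'] at hle
  have hlim := ENNReal.Tendsto.mul_const (ENNReal.tendsto_atTop_zero_of_tsum_ne_top hsum)
    (b := K * ‖u‖ₑ ^ s)
    (Or.inr (ENNReal.mul_ne_top hK (ENNReal.rpow_ne_top_of_nonneg hs enorm_ne_top)))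
  rw [zero_mul] at hlim
  have h0 := ge_of_tendsto' hlim hle
  rw [nonpos_iff_eq_zero, enorm_eq_zero, sub_eq_zero] at h0
  exact h0

/-- A sequence of probability measures whose characteristic functions converge pointwise to a
function continuous at `0` converges in law. -/
lemma exists_charFun_eq_of_tendsto {μs : ℕ → Measure (Vec d)} [∀ n, IsProbabilityMeasure (μs n)]
    {f : Vec d → ℂ} (hf : ContinuousAt f 0)
    (h : ∀ u, Tendsto (fun n => charFun (μs n) u) atTop (𝓝 (f u))) :
    ∃ μ : Measure (Vec d), IsProbabilityMeasure μ ∧ ∀ u, charFun μ u = f u := by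
  have htight := isTightMeasureSet_of_tendsto_charFun hf h
  let ps : ℕ → ProbabilityMeasure (Vec d) := fun n => ⟨μs n, inferInstance⟩
  have hcomp : IsCompact (closure (Set.range ps)) := by
    refine isCompact_closure_of_isTightMeasureSet (htight.subset ?_)
    rintro _ ⟨_, ⟨n, rfl⟩, rfl⟩
    exact ⟨n, rfl⟩
  obtain ⟨μ, -, hμ : Tendsto ps (hyperfilter ℕ) (𝓝 μ)⟩ :=
    hcomp.ultrafilter_le_nhds ((hyperfilter ℕ).map ps)
      ((le_principal_iff.2 (by simp)).trans (monotone_principal subset_closure))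
  refine ⟨μ, inferInstance, fun u => ?_⟩
  refine tendsto_nhds_unique ?_ ((h u).mono_left Nat.hyperfilter_le_atTop)
  rw [ProbabilityMeasure.tendsto_iff_forall_integral_rclike_tendsto ℂ] at hμ
  have := hμ (BoundedContinuousFunction.innerProbChar u)
  simp only [charFun_eq_integral_innerProbChar]
  exact this

/-- Iterating the smoothing transform from a law at finite Fourier distance from its image
converges to a fixed point, with uniform control of the Fourier distance. -/
lemma exists_isFixedPt (hN : N ≠ 0) (hC : ∀ i, Measurable (C i)) (hQ : Measurable Q)
    (μ₀ : Measure (Vec d)) [IsProbabilityMeasure μ₀] {s : ℝ} (hs : 0 < s)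
    (hsum : ∑' n, (N : ℝ≥0∞) ^ n * normMoment (productLaw (weightLaw P C) n) s ≠ ∞)
    {K : ℝ≥0∞} (hK : K ≠ ∞)
    (h : ∀ u, ‖charFun μ₀ u - charFun (smoothing P C Q μ₀) u‖ₑ ≤ K * ‖u‖ₑ ^ s) :
    ∃ μ : Measure (Vec d), IsProbabilityMeasure μ ∧ smoothing P C Q μ = μ ∧
      (∀ u, Tendsto (fun n => charFun ((smoothing P C Q)^[n] μ₀) u) atTop (𝓝 (charFun μ u))) ∧
      ∃ L : ℝ≥0∞, L ≠ ∞ ∧ ∀ u, ‖charFun μ u - charFun μ₀ u‖ₑ ≤ L * ‖u‖ₑ ^ s ∧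
        ∀ n, ‖charFun ((smoothing P C Q)^[n] μ₀) u - charFun μ₀ u‖ₑ ≤ L * ‖u‖ₑ ^ s := by
  have := isProbabilityMeasure_weightLaw (P := P) hN hC
  have := isProbabilityMeasure_smoothing (P := P) hC hQ μ₀
  have hprob := isProbabilityMeasure_iterate (P := P) hC hQ μ₀
  set T := smoothing P C Q with hT
  set a : ℕ → ℝ≥0∞ := fun n => (N : ℝ≥0∞) ^ n * normMoment (productLaw (weightLaw P C) n) s
  set L : ℝ≥0∞ := (∑' n, a n) * K
  have hL : L ≠ ∞ := ENNReal.mul_ne_top hsum hK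
  have htsum : ∀ u : Vec d, ∑' n, a n * (K * ‖u‖ₑ ^ s) = L * ‖u‖ₑ ^ s := fun u => by
    rw [ENNReal.tsum_mul_right, mul_assoc]
  have hfin : ∀ u : Vec d, L * ‖u‖ₑ ^ s ≠ ∞ := fun u =>
    ENNReal.mul_ne_top hL (ENNReal.rpow_ne_top_of_nonneg hs.le enorm_ne_top)
  have hstep : ∀ u n, edist (charFun (T^[n] μ₀) u) (charFun (T^[n.succ] μ₀) u) ≤
      a n * (K * ‖u‖ₑ ^ s) := fun u n => by
    rw [edist_eq_enorm_sub, Function.iterate_succ_apply]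
    exact enorm_charFun_iterate_sub_le_of_le hN hC hQ hs.le h n u
  have hcau : ∀ u, ∃ z, Tendsto (fun n => charFun (T^[n] μ₀) u) atTop (𝓝 z) := fun u =>
    cauchySeq_tendsto_of_complete (cauchySeq_of_edist_le_of_tsum_ne_top _ (hstep u)
      (by rw [htsum]; exact hfin u))
  choose f hf using hcau
  have hf0 : ∀ u, ‖f u - charFun μ₀ u‖ₑ ≤ L * ‖u‖ₑ ^ s := fun u => by
    have := edist_le_tsum_of_edist_le_of_tendsto₀ _ (hstep u) (hf u)
    rwa [htsum, edist_comm, edist_eq_enorm_sub] at this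
  have hcont : ContinuousAt f 0 := by
    have hlim : Tendsto (fun u : Vec d => L * ‖u‖ₑ ^ s) (𝓝 0) (𝓝 0) := by
      have h1 : Continuous fun u : Vec d => L * ‖u‖ₑ ^ s :=
        (ENNReal.continuous_const_mul hL).comp
          ((ENNReal.continuous_rpow_const).comp continuous_enorm)
      have h2 := h1.tendsto 0
      simpa [ENNReal.zero_rpow_of_pos hs] using h2
    have h0 : Tendsto (fun u => f u - charFun μ₀ u) (𝓝 0) (𝓝 0) := by
      rw [tendsto_zero_iff_enorm_tendsto_zero]
      exact tendsto_of_tendsto_of_tendsto_of_le_of_le tendsto_const_nhds hlim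
        (fun _ => zero_le) hf0
    have h1 : f 0 = charFun μ₀ 0 := by
      have := hf0 0
      simp only [enorm_zero, ENNReal.zero_rpow_of_pos hs, mul_zero, nonpos_iff_eq_zero,
        enorm_eq_zero, sub_eq_zero] at this
      exact this
    have h2 := h0.add (continuous_charFun (μ := μ₀).tendsto 0)
    rw [zero_add, ← h1] at h2
    exact h2.congr fun u => sub_add_cancel _ _
  obtain ⟨μ, hμ, hμf⟩ := exists_charFun_eq_of_tendsto hcont hf
  obtain rfl : charFun μ = f := funext hμf
  refine ⟨μ, hμ, ?_, hf, L, hL, fun u => ⟨hf0 u, fun n => ?_⟩⟩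
  · have := isProbabilityMeasure_smoothing (P := P) hC hQ μ
    refine Measure.ext_of_charFun (funext fun u => ?_)
    have hlim : Tendsto (fun n => charFun (T^[n + 1] μ₀) u) atTop (𝓝 (charFun (T μ) u)) := by
      rw [tendsto_iff_edist_tendsto_0]
      simp_rw [edist_eq_enorm_sub, Function.iterate_succ_apply']
      refine tendsto_of_tendsto_of_tendsto_of_le_of_le tendsto_const_nhds ?_
        (fun _ => zero_le) fun n => enorm_charFun_smoothing_sub_le hN hC hQ (T^[n] μ₀) μ u
      rw [← mul_zero (N : ℝ≥0∞)]
      refine ENNReal.Tendsto.const_mul ?_ (Or.inr (ENNReal.natCast_ne_top N))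
      have hz : ∫⁻ _ : Mat d, (0 : ℝ≥0∞) ∂(weightLaw P C) = 0 := by simp
      rw [← hz]
      refine tendsto_lintegral_of_dominated_convergence (fun _ => 2)
        (fun n => measurable_enorm_charFun_sub _ _ u) (fun n => Eventually.of_forall fun A => ?_)
        (by simp) (Eventually.of_forall fun A => ?_)
      · beta_reduce
        rw [← ofReal_norm]
        refine ENNReal.ofReal_le_of_le_toReal ((norm_sub_le _ _).trans ?_)
        rw [ENNReal.toReal_ofNat]
        have h1 := norm_charFun_le_one (μ := T^[n] μ₀) (act A.transpose u)
        have h2 := norm_charFun_le_one (μ := μ) (act A.transpose u)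
        linarith
      · have := tendsto_iff_edist_tendsto_0.1 (hf (act A.transpose u))
        simpa only [edist_eq_enorm_sub] using this
    exact tendsto_nhds_unique hlim ((tendsto_add_atTop_iff_nat 1).2 (hf u))
  · have := edist_le_range_sum_of_edist_le n (fun {k} _ => hstep u k)
    rw [edist_comm, edist_eq_enorm_sub] at this
    exact this.trans ((ENNReal.sum_le_tsum _).trans_eq (htsum u))

end FixedPoint

section Mean

variable {d : ℕ}

lemma norm_le_of_enorm_le {z : ℂ} {K : ℝ≥0∞} (hK : K ≠ ∞) {u : Vec d} {s : ℝ} (hs : 0 ≤ s)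
    (h : ‖z‖ₑ ≤ K * ‖u‖ₑ ^ s) : ‖z‖ ≤ K.toReal * ‖u‖ ^ s := by
  have hfin : K * ‖u‖ₑ ^ s ≠ ∞ :=
    ENNReal.mul_ne_top hK (ENNReal.rpow_ne_top_of_nonneg hs enorm_ne_top)
  simpa [ENNReal.toReal_mul, ← ENNReal.toReal_rpow] using ENNReal.toReal_mono hfin h

lemma integrable_of_lintegral_rpow_lt_top {μ : Measure (Vec d)} [IsProbabilityMeasure μ] {t : ℝ}
    (ht : 1 ≤ t) (h : ∫⁻ x, ‖x‖ₑ ^ t ∂μ < ∞) : Integrable (fun x => x) μ := by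
  refine ⟨by fun_prop, ?_⟩
  have := lintegral_rpow_le_one_add (μ := μ) (fun x : Vec d => ‖x‖ₑ) zero_le_one ht
  simp only [ENNReal.rpow_one] at this
  exact this.trans_lt (ENNReal.add_lt_top.2 ⟨ENNReal.one_lt_top, h⟩)

/-- Finite Fourier distance of order `s > 1` from the point mass at `r` determines the mean. -/
lemma integral_eq_of_enorm_charFun_sub_dirac_le {μ : Measure (Vec d)} [IsProbabilityMeasure μ]
    {s t : ℝ} (hs : 1 < s) (ht : 1 < t) (ht2 : t ≤ 2) (hμ : ∫⁻ x, ‖x‖ₑ ^ t ∂μ < ∞)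
    {r : Vec d} {K : ℝ≥0∞} (hK : K ≠ ∞)
    (h : ∀ u, ‖charFun μ u - charFun (Measure.dirac r) u‖ₑ ≤ K * ‖u‖ₑ ^ s) :
    Integrable (fun x => x) μ ∧ ∫ x, x ∂μ = r := by
  have hint := integrable_of_lintegral_rpow_lt_top ht.le hμ
  refine ⟨hint, ?_⟩
  set m := ∫ x, x ∂μ
  obtain ⟨K', hK', h'⟩ := exists_enorm_charFun_sub_dirac_le (by linarith) ht2 hμ (m := m)
    fun _ => ⟨hint, rfl⟩
  set v := m - r
  let G : ℝ → ℂ := fun ε => Complex.exp (((ε * ⟪m, v⟫ : ℝ) : ℂ) * Complex.I) -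
    Complex.exp (((ε * ⟪r, v⟫ : ℝ) : ℂ) * Complex.I)
  have hG : HasDerivAt G (((⟪m, v⟫ : ℝ) : ℂ) * Complex.I - ((⟪r, v⟫ : ℝ) : ℂ) * Complex.I) 0 := by
    have aux : ∀ x : ℝ, HasDerivAt (fun ε : ℝ => Complex.exp (((ε * x : ℝ) : ℂ) * Complex.I))
        ((x : ℂ) * Complex.I) 0 := fun x => by
      have h1 : HasDerivAt (fun ε : ℝ => ((ε * x : ℝ) : ℂ) * Complex.I) ((x : ℂ) * Complex.I) 0 := by
        have := ((hasDerivAt_id (0 : ℝ)).mul_const x).ofReal_comp.mul_const Complex.I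
        simpa using this
      simpa using h1.cexp
    exact (aux _).sub (aux _)
  have hbound : ∀ ε : ℝ, 0 < ε →
      ‖G ε‖ ≤ K.toReal * (ε * ‖v‖) ^ s + K'.toReal * (ε * ‖v‖) ^ t := fun ε hε => by
    have hn : ‖ε • v‖ = ε * ‖v‖ := by rw [norm_smul, Real.norm_eq_abs, abs_of_pos hε]
    have h1 := norm_le_of_enorm_le hK (by linarith) (h (ε • v))
    have h2 := norm_le_of_enorm_le hK' (by linarith) (h' (ε • v))
    rw [hn] at h1 h2
    have heq : G ε = charFun (Measure.dirac m) (ε • v) - charFun (Measure.dirac r) (ε • v) := by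
      simp only [G, charFun_dirac, real_inner_smul_right]
    rw [heq]
    calc _ = ‖(charFun μ (ε • v) - charFun (Measure.dirac r) (ε • v)) -
          (charFun μ (ε • v) - charFun (Measure.dirac m) (ε • v))‖ := by congr 1; ring
      _ ≤ _ := (norm_sub_le _ _).trans (add_le_add h1 h2)
  have hpow : ∀ p : ℝ, 1 < p → ∀ c : ℝ,
      Tendsto (fun ε : ℝ => ε⁻¹ * (c * (ε * ‖v‖) ^ p)) (𝓝[>] 0) (𝓝 0) := fun p hp c => by
    have h1 : Tendsto (fun ε : ℝ => c * ‖v‖ ^ p * ε ^ (p - 1)) (𝓝[>] 0) (𝓝 0) := by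
      have h2 : ContinuousAt (fun ε : ℝ => c * ‖v‖ ^ p * ε ^ (p - 1)) 0 :=
        continuousAt_const.mul (Real.continuousAt_rpow_const _ _ (Or.inr (by linarith)))
      have h3 := h2.tendsto.mono_left (nhdsWithin_le_nhds (s := Set.Ioi (0 : ℝ)))
      simpa [Real.zero_rpow (by linarith : p - 1 ≠ 0)] using h3
    refine h1.congr' ?_
    filter_upwards [self_mem_nhdsWithin] with ε hε
    have hε' : 0 < ε := hε
    rw [Real.mul_rpow hε'.le (norm_nonneg v), Real.rpow_sub_one hε'.ne']
    field_simp
  have hslope := (hasDerivAt_iff_tendsto_slope_zero.1 hG).mono_left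
    (nhdsWithin_mono 0 (fun x (hx : (0 : ℝ) < x) => hx.ne') : 𝓝[>] (0 : ℝ) ≤ 𝓝[≠] 0)
  have hslope0 : Tendsto (fun ε : ℝ => ε⁻¹ • (G (0 + ε) - G 0)) (𝓝[>] 0) (𝓝 0) := by
    have hs0 := (hpow s hs K.toReal).add (hpow t ht K'.toReal)
    rw [add_zero] at hs0
    refine squeeze_zero_norm' ?_ hs0
    filter_upwards [self_mem_nhdsWithin] with ε hε
    have hε' : 0 < ε := hε
    have hG0 : G 0 = 0 := by simp [G]
    rw [hG0, zero_add, sub_zero, norm_smul, norm_inv, Real.norm_eq_abs, abs_of_pos hε', ← mul_add]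
    exact mul_le_mul_of_nonneg_left (hbound ε hε') (by positivity)
  have hz := tendsto_nhds_unique hslope hslope0
  rw [← sub_mul, mul_eq_zero, or_iff_left Complex.I_ne_zero, ← Complex.ofReal_sub,
    Complex.ofReal_eq_zero, ← inner_sub_left] at hz
  exact sub_eq_zero.1 (inner_self_eq_zero.1 hz)

end Mean

section TailBounds

lemma sum_rpow_le_card_mul {ι : Type*} (s : Finset ι) (a : ι → ℝ≥0∞) {t : ℝ} (ht : 0 < t) :
    (∑ i ∈ s, a i) ^ t ≤ (s.card : ℝ≥0∞) ^ t * ∑ i ∈ s, a i ^ t := by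
  rcases s.eq_empty_or_nonempty with rfl | hs
  · simp [ht]
  obtain ⟨j, hj, hmax⟩ := s.exists_max_image a hs
  calc (∑ i ∈ s, a i) ^ t ≤ (s.card * a j) ^ t := by
        gcongr
        rw [← nsmul_eq_mul]
        exact Finset.sum_le_card_nsmul _ _ _ hmax
    _ = (s.card : ℝ≥0∞) ^ t * a j ^ t := ENNReal.mul_rpow_of_nonneg _ _ ht.le
    _ ≤ _ := by
        gcongr
        exact Finset.single_le_sum (f := fun i => a i ^ t) (fun _ _ => zero_le) hj

lemma add_rpow_le_two_mul (a b : ℝ≥0∞) {t : ℝ} (ht : 0 < t) :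
    (a + b) ^ t ≤ 2 ^ t * (a ^ t + b ^ t) := by
  have h := sum_rpow_le_card_mul (Finset.univ : Finset (Fin 2)) ![a, b] ht
  simpa [Fin.sum_univ_two] using h

variable {d : ℕ}

lemma measureReal_inner_gt_le {μ : Measure (Vec d)} [IsProbabilityMeasure μ] {s K : ℝ}
    (hs : 0 ≤ s) (hK : 0 ≤ K) (h : ∀ u, ‖1 - charFun μ u‖ ≤ K * ‖u‖ ^ s) {a : Vec d}
    (ha : ‖a‖ = 1) {R : ℝ} (hR : 0 < R) :
    μ.real {x | R < |⟪a, x⟫|} ≤ 2 * K * 2 ^ s * R ^ (-s) := by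
  refine (measureReal_abs_inner_gt_le_integral_charFun hR).trans ?_
  have hint : ‖∫ t in -2 * R⁻¹..2 * R⁻¹, 1 - charFun μ (t • a)‖ ≤
      K * (2 * R⁻¹) ^ s * |2 * R⁻¹ - -2 * R⁻¹| := by
    refine intervalIntegral.norm_integral_le_of_norm_le_const fun t ht => ?_
    refine (h _).trans ?_
    rw [norm_smul, ha, mul_one, Real.norm_eq_abs]
    have hpos : 0 < 2 * R⁻¹ := by positivity
    rw [Set.uIoc_of_le (by linarith)] at ht
    have : |t| ≤ 2 * R⁻¹ := abs_le.2 ⟨by linarith [ht.1], ht.2⟩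
    gcongr
  have habs : |2 * R⁻¹ - -2 * R⁻¹| = 4 * R⁻¹ := by
    rw [abs_of_pos] <;> ring_nf
    positivity
  calc _ ≤ 2⁻¹ * R * (K * (2 * R⁻¹) ^ s * (4 * R⁻¹)) := by
        rw [← habs]
        gcongr
    _ = 2 * K * 2 ^ s * R ^ (-s) := by
        rw [Real.mul_rpow zero_le_two (by positivity), Real.inv_rpow hR.le, Real.rpow_neg hR.le]
        field_simp
        ring

lemma lintegral_abs_rpow_le_of_tail {α : Type*} [MeasurableSpace α] {s t D : ℝ} (ht : 0 < t)
    (hts : t < s) (hD : 0 ≤ D) :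
    ∃ B : ℝ≥0∞, B ≠ ∞ ∧ ∀ (μ : Measure α) [IsProbabilityMeasure μ] (f : α → ℝ),
      Measurable f → (∀ R : ℝ, 0 < R → μ.real {x | R < |f x|} ≤ D * R ^ (-s)) →
      ∫⁻ x, ‖f x‖ₑ ^ t ∂μ ≤ B := by
  refine ⟨ENNReal.ofReal t * ((∫⁻ R in Set.Ioc (0 : ℝ) 1, ENNReal.ofReal (R ^ (t - 1))) +
    ∫⁻ R in Set.Ioi (1 : ℝ), ENNReal.ofReal (D * R ^ (-s + (t - 1)))), ?_, ?_⟩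
  · refine ENNReal.mul_ne_top ENNReal.ofReal_ne_top (ENNReal.add_ne_top.2 ⟨?_, ?_⟩)
    · have h := intervalIntegral.intervalIntegrable_rpow' (a := 0) (b := 1)
        (by linarith : -1 < t - 1)
      rw [intervalIntegrable_iff_integrableOn_Ioc_of_le zero_le_one] at h
      exact h.lintegral_lt_top.ne
    · have h := (integrableOn_Ioi_rpow_of_lt (by linarith : -s + (t - 1) < -1)
        zero_lt_one).const_mul D
      exact h.lintegral_lt_top.ne
  · intro μ _ f hf htail
    have hlayer := lintegral_rpow_eq_lintegral_meas_lt_mul μ (f := fun x => |f x|)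
      (Eventually.of_forall fun x => abs_nonneg _) hf.abs.aemeasurable ht
    have hrw : ∀ x, ENNReal.ofReal (|f x| ^ t) = ‖f x‖ₑ ^ t := fun x => by
      rw [← ENNReal.ofReal_rpow_of_nonneg (abs_nonneg _) ht.le, ← Real.norm_eq_abs, ofReal_norm]
    simp_rw [hrw] at hlayer
    rw [hlayer, ← Set.Ioc_union_Ioi_eq_Ioi zero_le_one]
    gcongr
    refine (lintegral_union_le _ _ _).trans (add_le_add ?_ ?_)
    · refine lintegral_mono fun R => ?_
      exact mul_le_of_le_one_left zero_le prob_le_one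
    · refine setLIntegral_mono' measurableSet_Ioi fun R hR => ?_
      have hR0 : 0 < R := zero_lt_one.trans hR
      rw [Real.rpow_add hR0, ← mul_assoc, ENNReal.ofReal_mul (by positivity)]
      gcongr
      rw [← ofReal_measureReal]
      exact ENNReal.ofReal_le_ofReal (htail R hR0)

/-- Finite Fourier distance of order `s` from a point mass bounds the moments of order `t < s`. -/
lemma exists_lintegral_rpow_le (m : Vec d) {s t : ℝ} (ht : 0 < t) (hts : t < s) {K : ℝ≥0∞}
    (hK : K ≠ ∞) :
    ∃ B : ℝ≥0∞, B ≠ ∞ ∧ ∀ (μ : Measure (Vec d)) [IsProbabilityMeasure μ],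
      (∀ u, ‖charFun μ u - charFun (Measure.dirac m) u‖ₑ ≤ K * ‖u‖ₑ ^ s) →
      ∫⁻ x, ‖x‖ₑ ^ t ∂μ ≤ B := by
  have hs : 0 < s := ht.trans hts
  obtain ⟨B, hB, hBt⟩ := lintegral_abs_rpow_le_of_tail (α := Vec d) ht hts
    (D := 2 * K.toReal * 2 ^ s) (by positivity)
  refine ⟨2 ^ t * ((d : ℝ≥0∞) ^ t * (d * B) + ‖m‖ₑ ^ t), ?_, fun μ _ h => ?_⟩
  · have htop := fun (x : ℝ≥0∞) (hx : x ≠ ∞) => ENNReal.rpow_ne_top_of_nonneg ht.le hx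
    refine ENNReal.mul_ne_top (htop _ (by simp)) (ENNReal.add_ne_top.2 ⟨ENNReal.mul_ne_top
      (htop _ (ENNReal.natCast_ne_top d)) (ENNReal.mul_ne_top (ENNReal.natCast_ne_top d) hB),
      htop _ enorm_ne_top⟩)
  · set μ' := μ.map (· + (-m))
    have : IsProbabilityMeasure μ' := Measure.isProbabilityMeasure_map (by fun_prop)
    have hμ' : ∀ u, ‖1 - charFun μ' u‖ ≤ K.toReal * ‖u‖ ^ s := fun u => by
      have h1 := norm_le_of_enorm_le hK hs.le (h u)
      have h2 : 1 - charFun μ' u = -((charFun μ u - charFun (Measure.dirac m) u) *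
          Complex.exp (((⟪-m, u⟫ : ℝ) : ℂ) * Complex.I)) := by
        rw [charFun_map_add_const, sub_mul, charFun_dirac, ← Complex.exp_add, inner_neg_left]
        simp
      rwa [h2, norm_neg, norm_mul, Complex.norm_exp_ofReal_mul_I, mul_one]
    have hcoord : ∀ j, ∫⁻ x, ‖x.ofLp j‖ₑ ^ t ∂μ' ≤ B := fun j => by
      refine hBt μ' (fun x => x.ofLp j) (by fun_prop) fun R hR => ?_
      have := measureReal_inner_gt_le hs.le ENNReal.toReal_nonneg hμ'
        (a := EuclideanSpace.single j (1 : ℝ)) (by simp) hR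
      simpa [EuclideanSpace.inner_single_left] using this
    have hnorm : ∀ x : Vec d, ‖x‖ₑ ≤ ∑ j, ‖x.ofLp j‖ₑ := fun x => by
      have hx : x = ∑ j, EuclideanSpace.single j (x.ofLp j) := by
        ext i; simp [Finset.sum_apply, Pi.single_apply]
      calc ‖x‖ₑ = ‖∑ j, EuclideanSpace.single j (x.ofLp j)‖ₑ := by rw [← hx]
        _ ≤ ∑ j, ‖EuclideanSpace.single j (x.ofLp j)‖ₑ := enorm_sum_le _ _
        _ = _ := by
          refine Finset.sum_congr rfl fun j _ => ?_
          rw [← ofReal_norm, PiLp.norm_single, ofReal_norm]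
    have hmom : ∫⁻ x, ‖x‖ₑ ^ t ∂μ' ≤ (d : ℝ≥0∞) ^ t * (d * B) := by
      calc ∫⁻ x, ‖x‖ₑ ^ t ∂μ' ≤ ∫⁻ x, (d : ℝ≥0∞) ^ t * ∑ j, ‖x.ofLp j‖ₑ ^ t ∂μ' := by
            refine lintegral_mono fun x => ?_
            have := sum_rpow_le_card_mul Finset.univ (fun j => ‖x.ofLp j‖ₑ) ht
            rw [Finset.card_univ, Fintype.card_fin] at this
            exact (ENNReal.rpow_le_rpow (hnorm x) ht.le).trans this
        _ = (d : ℝ≥0∞) ^ t * ∑ j, ∫⁻ x, ‖x.ofLp j‖ₑ ^ t ∂μ' := by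
            have hm : ∀ j, Measurable fun x : Vec d => ‖x.ofLp j‖ₑ ^ t := fun j =>
              (Measurable.enorm (by fun_prop)).pow_const t
            rw [lintegral_const_mul _ (Finset.measurable_sum _ fun j _ => hm j),
              lintegral_finsetSum _ fun j _ => hm j]
        _ ≤ _ := by
            gcongr
            refine (Finset.sum_le_card_nsmul _ _ B fun j _ => hcoord j).trans_eq ?_
            simp
    have hmeas : Measurable fun x : Vec d => ‖x‖ₑ ^ t := measurable_enorm.pow_const t
    rw [lintegral_map hmeas (by fun_prop)] at hmom
    calc ∫⁻ x, ‖x‖ₑ ^ t ∂μ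
        ≤ ∫⁻ x, 2 ^ t * (‖x + -m‖ₑ ^ t + ‖m‖ₑ ^ t) ∂μ := by
          refine lintegral_mono fun x => ?_
          refine le_trans ?_ (add_rpow_le_two_mul _ _ ht)
          refine ENNReal.rpow_le_rpow ?_ ht.le
          simpa using enorm_add_le (x + -m) m
      _ = 2 ^ t * (∫⁻ x, ‖x + -m‖ₑ ^ t ∂μ + ‖m‖ₑ ^ t) := by
          rw [lintegral_const_mul' _ _ (ENNReal.rpow_ne_top_of_nonneg ht.le (by simp)),
            lintegral_add_right _ measurable_const]
          simp
      _ ≤ _ := by gcongr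

/-- Moments are lower semicontinuous under convergence of characteristic functions. -/
lemma lintegral_rpow_le_of_tendsto_charFun {μs : ℕ → Measure (Vec d)}
    [∀ n, IsProbabilityMeasure (μs n)] {μ : Measure (Vec d)} [IsProbabilityMeasure μ]
    (h : ∀ u, Tendsto (fun n => charFun (μs n) u) atTop (𝓝 (charFun μ u))) {t : ℝ} (ht : 0 < t)
    {B : ℝ≥0∞} (hB : ∀ n, ∫⁻ x, ‖x‖ₑ ^ t ∂(μs n) ≤ B) : ∫⁻ x, ‖x‖ₑ ^ t ∂μ ≤ B := by
  let ps : ℕ → ProbabilityMeasure (Vec d) := fun n => ⟨μs n, inferInstance⟩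
  let p : ProbabilityMeasure (Vec d) := ⟨μ, inferInstance⟩
  have hlim : Tendsto ps atTop (𝓝 p) := ProbabilityMeasure.tendsto_of_tendsto_charFun h
  have hfatou := lintegral_le_liminf_lintegral_of_forall_isOpen_measure_le_liminf_measure
    (μ := μ) (μs := μs) (f := fun x : Vec d => ‖x‖ ^ t)
    (continuous_norm.rpow_const fun _ => Or.inr ht.le)
    (fun x => Real.rpow_nonneg (norm_nonneg x) t)
    (fun G hG => ProbabilityMeasure.le_liminf_measure_open_of_tendsto hlim hG)
  have hrw : ∀ x : Vec d, ENNReal.ofReal (‖x‖ ^ t) = ‖x‖ₑ ^ t := fun x => by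
    rw [← ENNReal.ofReal_rpow_of_nonneg (norm_nonneg _) ht.le, ofReal_norm]
  simp_rw [hrw] at hfatou
  exact hfatou.trans (liminf_le_of_frequently_le' (Frequently.of_forall hB))

end TailBounds

section PowerSums

lemma rpow_sum_le_sum_rpow {ι : Type*} (s : Finset ι) (b : ι → ℝ≥0∞) {t : ℝ} (h0 : 0 < t)
    (h1 : t ≤ 1) : (∑ i ∈ s, b i) ^ t ≤ ∑ i ∈ s, b i ^ t := by
  classical
  induction s using Finset.induction_on with
  | empty => simp [h0]
  | insert j s hj ih =>
    rw [Finset.sum_insert hj, Finset.sum_insert hj]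
    exact (ENNReal.rpow_add_le_add_rpow _ _ h0.le h1).trans (by gcongr)

lemma add_rpow_le_rpow_add_mul {a b : ℝ≥0∞} (ha : a ≠ ∞) (hb : b ≠ ∞) {t : ℝ} (ht : 1 ≤ t) :
    (a + b) ^ t ≤ a ^ t + ENNReal.ofReal t * (a + b) ^ (t - 1) * b := by
  have key : ∀ x y : ℝ, 0 ≤ x → 0 ≤ y → (x + y) ^ t ≤ x ^ t + t * (x + y) ^ (t - 1) * y := by
    intro x y hx hy
    rcases (add_nonneg hx hy).eq_or_lt with h | h
    · rw [← h, Real.zero_rpow (by linarith)]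
      have h1 := Real.rpow_nonneg hx t
      have h2 := Real.rpow_nonneg le_rfl (t - 1)
      positivity
    · have hle : y / (x + y) ≤ 1 := (div_le_one h).2 (by linarith)
      have hb := one_add_mul_self_le_rpow_one_add (s := -(y / (x + y))) (by linarith) ht
      have hx' : 1 + -(y / (x + y)) = x / (x + y) := by field_simp; ring
      rw [hx', Real.div_rpow hx h.le, le_div_iff₀ (Real.rpow_pos_of_pos h t)] at hb
      have hpow : (x + y) ^ t = (x + y) ^ (t - 1) * (x + y) := by
        rw [← Real.rpow_add_one h.ne']; simp
      have h3 : (1 + t * -(y / (x + y))) * (x + y) ^ t =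
          (x + y) ^ t - t * (x + y) ^ (t - 1) * y := by
        rw [hpow]; field_simp; ring
      linarith
  have ht0 : 0 ≤ t := by linarith
  have ht1 : 0 ≤ t - 1 := by linarith
  have h := ENNReal.ofReal_le_ofReal (key a.toReal b.toReal ENNReal.toReal_nonneg
    ENNReal.toReal_nonneg)
  have hab : 0 ≤ a.toReal + b.toReal := by positivity
  rw [ENNReal.ofReal_add (by positivity) (by positivity), ENNReal.ofReal_mul (by positivity),
    ENNReal.ofReal_mul ht0, ← ENNReal.ofReal_rpow_of_nonneg hab ht0,
    ← ENNReal.ofReal_rpow_of_nonneg hab ht1,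
    ← ENNReal.ofReal_rpow_of_nonneg ENNReal.toReal_nonneg ht0,
    ENNReal.ofReal_add ENNReal.toReal_nonneg ENNReal.toReal_nonneg, ENNReal.ofReal_toReal ha,
    ENNReal.ofReal_toReal hb] at h
  exact h

/-- The mixed terms in the expansion of a power of a sum. -/
noncomputable def crossTerms {ι : Type*} [Fintype ι] [DecidableEq ι] (t : ℝ) (b : ι → ℝ≥0∞) :
    ℝ≥0∞ :=
  ∑ i, ∑ j ∈ Finset.univ.erase i, b i ^ (t - 1) * b j

lemma rpow_sum_le_sum_rpow_add_crossTerms {ι : Type*} [Fintype ι] [DecidableEq ι]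
    {b : ι → ℝ≥0∞} (hb : ∀ i, b i ≠ ∞) {t : ℝ} (ht : 1 ≤ t) :
    (∑ i, b i) ^ t ≤ ∑ i, b i ^ t +
      ENNReal.ofReal t * (Fintype.card ι : ℝ≥0∞) ^ (t - 1) * crossTerms t b := by
  have ht1 : 0 ≤ t - 1 := by linarith
  rcases isEmpty_or_nonempty ι with hι | hι
  · simp [show 0 < t by linarith]
  obtain ⟨k, -, hk⟩ := Finset.univ.exists_max_image b Finset.univ_nonempty
  have hsum : ∑ i, b i = b k + ∑ j ∈ Finset.univ.erase k, b j :=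
    (Finset.add_sum_erase _ _ (Finset.mem_univ k)).symm
  have hmax : ∑ i, b i ≤ Fintype.card ι * b k := by
    rw [← nsmul_eq_mul]
    exact Finset.sum_le_card_nsmul _ _ _ hk
  calc (∑ i, b i) ^ t
      ≤ b k ^ t + ENNReal.ofReal t * (∑ i, b i) ^ (t - 1) *
          ∑ j ∈ Finset.univ.erase k, b j := by
        rw [hsum]
        exact add_rpow_le_rpow_add_mul (hb k) (ENNReal.sum_ne_top.2 fun j _ => hb j) ht
    _ ≤ ∑ i, b i ^ t + ENNReal.ofReal t * (Fintype.card ι * b k) ^ (t - 1) *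
          ∑ j ∈ Finset.univ.erase k, b j := by
        gcongr
        exact Finset.single_le_sum (f := fun i => b i ^ t) (fun _ _ => zero_le)
          (Finset.mem_univ k)
    _ = ∑ i, b i ^ t + ENNReal.ofReal t * (Fintype.card ι : ℝ≥0∞) ^ (t - 1) *
          ∑ j ∈ Finset.univ.erase k, b k ^ (t - 1) * b j := by
        rw [ENNReal.mul_rpow_of_nonneg _ _ ht1, ← Finset.mul_sum]
        ring
    _ ≤ _ := by
        gcongr
        exact Finset.single_le_sum
          (f := fun i => ∑ j ∈ Finset.univ.erase i, b i ^ (t - 1) * b j)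
          (fun _ _ => zero_le) (Finset.mem_univ k)

end PowerSums

section Lyapunov

variable {N d : ℕ} {ν : Measure (Mat d)} {t : ℝ}

/-- The sum over all generations of the expected `t`-th powers of the branches started at `x`. -/
noncomputable def lyapunov {d : ℕ} (N : ℕ) (ν : Measure (Mat d)) (t : ℝ) (x : Vec d) : ℝ≥0∞ :=
  ∑' n, (N : ℝ≥0∞) ^ n * ∫⁻ A, ‖act A x‖ₑ ^ t ∂(productLaw ν n)

lemma measurable_enorm_act_rpow (x : Vec d) (t : ℝ) :
    Measurable fun A : Mat d => ‖act A x‖ₑ ^ t :=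
  (measurable_act' measurable_id measurable_const).enorm.pow_const t

lemma measurable_lyapunov [IsProbabilityMeasure ν] : Measurable (lyapunov N ν t) := by
  refine Measurable.tsum fun n => Measurable.const_mul ?_ _
  exact Measurable.lintegral_prod_right' (f := fun p : Vec d × Mat d => ‖act p.2 p.1‖ₑ ^ t)
    ((measurable_act' measurable_snd measurable_fst).enorm.pow_const t)

lemma lyapunov_le (ht : 0 ≤ t) (x : Vec d) :
    lyapunov N ν t x ≤ (∑' n, (N : ℝ≥0∞) ^ n * normMoment (productLaw ν n) t) * ‖x‖ₑ ^ t := by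
  rw [← ENNReal.tsum_mul_right]
  refine ENNReal.tsum_le_tsum fun n => ?_
  rw [mul_assoc, normMoment, ← lintegral_mul_const _ (measurable_opNorm.pow_const t)]
  gcongr with A
  rw [← ENNReal.mul_rpow_of_nonneg _ _ ht]
  exact ENNReal.rpow_le_rpow (enorm_act_le A x) ht

lemma lyapunov_eq [IsProbabilityMeasure ν] (x : Vec d) :
    lyapunov N ν t x = ‖x‖ₑ ^ t + N * ∫⁻ B, lyapunov N ν t (act B x) ∂ν := by
  rw [lyapunov, tsum_eq_zero_add' ENNReal.summable]
  congr 1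
  · rw [lintegral_productLaw_zero _ (measurable_enorm_act_rpow x t)]
    simp [act_one]
  · have hm : ∀ n, Measurable fun B : Mat d =>
        (N : ℝ≥0∞) ^ n * ∫⁻ A, ‖act A (act B x)‖ₑ ^ t ∂(productLaw ν n) := fun n =>
      Measurable.const_mul (Measurable.lintegral_prod_right'
        (f := fun p : Mat d × Mat d => ‖act p.2 (act p.1 x)‖ₑ ^ t)
        ((measurable_act' measurable_snd
          (measurable_act' measurable_fst measurable_const)).enorm.pow_const t)) _
    simp only [lyapunov]
    rw [lintegral_tsum fun n => (hm n).aemeasurable, ← ENNReal.tsum_mul_left]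
    refine tsum_congr fun n => ?_
    rw [lintegral_productLaw_succ n (measurable_enorm_act_rpow x t),
      lintegral_const_mul' _ _ (ENNReal.pow_ne_top (ENNReal.natCast_ne_top N)), pow_succ',
      ← mul_assoc]
    congr 1
    rw [lintegral_lintegral_swap]
    · simp_rw [act_mul]
    · exact (((measurable_act' measurable_mul' measurable_const).enorm.pow_const
        t)).aemeasurable

lemma rpow_le_lyapunov [IsProbabilityMeasure ν] (x : Vec d) : ‖x‖ₑ ^ t ≤ lyapunov N ν t x := by
  rw [lyapunov_eq]
  exact le_self_add

/-- A pointwise bound for the `t`-th power of a sum passes to `lyapunov`. -/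
lemma lyapunov_sum_le {ι : Type*} [Fintype ι] {a : ι → Vec d} {Y : ℝ≥0∞}
    (h : ∀ A : Mat d, ‖act A (∑ i, a i)‖ₑ ^ t ≤ ∑ i, ‖act A (a i)‖ₑ ^ t + opNorm A ^ t * Y) :
    lyapunov N ν t (∑ i, a i) ≤ ∑ i, lyapunov N ν t (a i) +
      (∑' n, (N : ℝ≥0∞) ^ n * normMoment (productLaw ν n) t) * Y := by
  simp only [lyapunov]
  rw [← Summable.tsum_finsetSum fun _ _ => ENNReal.summable, ← ENNReal.tsum_mul_right,
    ← ENNReal.tsum_add]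
  refine ENNReal.tsum_le_tsum fun n => ?_
  rw [← Finset.mul_sum, mul_assoc, ← mul_add]
  gcongr
  rw [← lintegral_finsetSum _ fun i _ => measurable_enorm_act_rpow _ t, normMoment,
    ← lintegral_mul_const _ (measurable_opNorm.pow_const t), ← lintegral_add_right]
  · exact lintegral_mono h
  · exact (measurable_opNorm.pow_const t).mul_const _

lemma enorm_act_sum_rpow_le_of_le_one {ι : Type*} [Fintype ι] (h0 : 0 < t) (h1 : t ≤ 1)
    (a : ι → Vec d) (A : Mat d) :
    ‖act A (∑ i, a i)‖ₑ ^ t ≤ ∑ i, ‖act A (a i)‖ₑ ^ t + opNorm A ^ t * 0 := by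
  rw [mul_zero, add_zero, act_sum]
  exact (ENNReal.rpow_le_rpow (enorm_sum_le _ _) h0.le).trans (rpow_sum_le_sum_rpow _ _ h0 h1)

lemma enorm_act_sum_rpow_le {ι : Type*} [Fintype ι] [DecidableEq ι] (ht : 1 ≤ t)
    (a : ι → Vec d) (A : Mat d) :
    ‖act A (∑ i, a i)‖ₑ ^ t ≤ ∑ i, ‖act A (a i)‖ₑ ^ t + opNorm A ^ t *
      (ENNReal.ofReal t * (Fintype.card ι : ℝ≥0∞) ^ (t - 1) *
        crossTerms t fun i => ‖a i‖ₑ) := by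
  have ht1 : 0 ≤ t - 1 := by linarith
  rw [act_sum]
  refine (ENNReal.rpow_le_rpow (enorm_sum_le _ _) (by linarith)).trans
    ((rpow_sum_le_sum_rpow_add_crossTerms (fun i => enorm_ne_top) ht).trans ?_)
  rw [mul_left_comm]
  gcongr
  rw [crossTerms, crossTerms, Finset.mul_sum]
  refine Finset.sum_le_sum fun i _ => ?_
  rw [Finset.mul_sum]
  refine Finset.sum_le_sum fun j _ => ?_
  calc ‖act A (a i)‖ₑ ^ (t - 1) * ‖act A (a j)‖ₑ
      ≤ (opNorm A * ‖a i‖ₑ) ^ (t - 1) * (opNorm A * ‖a j‖ₑ) := by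
        gcongr <;> exact enorm_act_le _ _
    _ = opNorm A ^ (t - 1) * opNorm A ^ (1 : ℝ) * (‖a i‖ₑ ^ (t - 1) * ‖a j‖ₑ) := by
        rw [ENNReal.mul_rpow_of_nonneg _ _ ht1, ENNReal.rpow_one]; ring
    _ = _ := by
        rw [← ENNReal.rpow_add_of_nonneg _ _ ht1 zero_le_one, sub_add_cancel]

end Lyapunov

section Summands

variable {Ω : Type*} {N d : ℕ} {C : Fin N → Ω → Mat d} {Q : Ω → Vec d}

/-- The summands `C i (x i)` and `Q` of the smoothing transform. -/
noncomputable def summand (C : Fin N → Ω → Mat d) (Q : Ω → Vec d) (ω : Ω) (x : Fin N → Vec d) :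
    Option (Fin N) → Vec d
  | none => Q ω
  | some i => act (C i ω) (x i)

lemma sum_summand (ω : Ω) (x : Fin N → Vec d) :
    ∑ k, summand C Q ω x k = ∑ i, act (C i ω) (x i) + Q ω := by
  rw [Fintype.sum_option, add_comm]
  rfl

/-- The scalar weight of each summand. -/
noncomputable def summandWeight (C : Fin N → Ω → Mat d) (Q : Ω → Vec d) (ω : Ω) :
    Option (Fin N) → ℝ≥0∞
  | none => ‖Q ω‖ₑ
  | some i => opNorm (C i ω)

/-- The size of the argument of each summand. -/
noncomputable def summandSize (x : Fin N → Vec d) : Option (Fin N) → ℝ≥0∞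
  | none => 1
  | some i => ‖x i‖ₑ

lemma enorm_summand_le (ω : Ω) (x : Fin N → Vec d) (k : Option (Fin N)) :
    ‖summand C Q ω x k‖ₑ ≤ summandWeight C Q ω k * summandSize x k := by
  cases k with
  | none => simp [summand, summandWeight, summandSize]
  | some i => exact enorm_act_le _ _

end Summands

section Recursion

lemma le_max_of_recursion {x y : ℕ → ℝ≥0∞} {S c : ℝ≥0∞} (hS : S ≠ ∞) (hc : c ≠ ∞)
    (hrec : ∀ n, x (n + 1) + y n ≤ x n + c) (hyx : ∀ n, y n ≤ x n) (hxy : ∀ n, x n ≤ S * y n)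
    (h0 : x 0 ≠ ∞) (n : ℕ) : x n ≤ max (x 0) (S * c + c) := by
  induction n with
  | zero => exact le_max_left _ _
  | succ n ih =>
    rcases le_total (y n) c with h | h
    · refine le_max_of_le_right (le_self_add.trans ((hrec n).trans ?_))
      gcongr
      exact (hxy n).trans (by gcongr)
    · have hfin : y n ≠ ∞ := ne_top_of_le_ne_top
        (max_lt h0.lt_top (ENNReal.add_ne_top.2 ⟨ENNReal.mul_ne_top hS hc, hc⟩).lt_top).ne
        ((hyx n).trans ih)
      have h1 : x (n + 1) + y n ≤ x n + y n := (hrec n).trans (by gcongr)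
      exact ((ENNReal.add_le_add_iff_right hfin).1 h1).trans ih

lemma rpow_sub_one_mul_le (a b : ℝ≥0∞) {t : ℝ} (ht : 1 ≤ t) :
    a ^ (t - 1) * b ≤ a ^ t + b ^ t := by
  have key : ∀ c : ℝ≥0∞, c ^ (t - 1) * c = c ^ t := fun c => by
    conv_lhs => rw [← ENNReal.rpow_one c, ← ENNReal.rpow_mul, one_mul,
      ← ENNReal.rpow_add_of_nonneg _ _ (by linarith) zero_le_one, sub_add_cancel]
  rcases le_total a b with h | h
  · refine le_trans ?_ le_add_self
    rw [← key b]
    gcongr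
  · refine le_trans ?_ le_self_add
    rw [← key a]
    gcongr

variable {Ω : Type*} [MeasurableSpace Ω] {P : Measure Ω} {N d : ℕ} {C : Fin N → Ω → Mat d}
  {Q : Ω → Vec d} {t : ℝ}

lemma measurable_summand (hC : ∀ i, Measurable (C i)) (hQ : Measurable Q) (k : Option (Fin N)) :
    Measurable fun p : Ω × (Fin N → Vec d) => summand C Q p.1 p.2 k := by
  cases k with
  | none => exact hQ.comp measurable_fst
  | some i =>
    exact measurable_act' ((hC i).comp measurable_fst)
      ((measurable_pi_apply i).comp measurable_snd)

lemma measurable_summandWeight (hC : ∀ i, Measurable (C i)) (hQ : Measurable Q)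
    (k : Option (Fin N)) : Measurable fun ω => summandWeight C Q ω k := by
  cases k with
  | none => exact hQ.enorm
  | some i => exact measurable_opNorm.comp (hC i)

lemma measurable_summandSize (k : Option (Fin N)) :
    Measurable fun x : Fin N → Vec d => summandSize x k := by
  cases k with
  | none => exact measurable_const
  | some i => exact (measurable_pi_apply i).enorm

lemma lintegral_eval (μ : Measure (Vec d)) [IsProbabilityMeasure μ] (i : Fin N)
    {f : Vec d → ℝ≥0∞} (hf : Measurable f) :
    ∫⁻ x, f (x i) ∂(Measure.pi fun _ : Fin N => μ) = ∫⁻ x, f x ∂μ :=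
  (measurePreserving_eval (fun _ : Fin N => μ) i).lintegral_comp hf

lemma lintegral_eval_mul_eval (μ : Measure (Vec d)) [IsProbabilityMeasure μ] {i j : Fin N}
    (hij : i ≠ j) {f g : Vec d → ℝ≥0∞} (hf : Measurable f) (hg : Measurable g) :
    ∫⁻ x, f (x i) * g (x j) ∂(Measure.pi fun _ : Fin N => μ) =
      (∫⁻ x, f x ∂μ) * ∫⁻ x, g x ∂μ := by
  have hind := (ProbabilityTheory.iIndepFun_pi (μ := fun _ : Fin N => μ)
    (X := fun _ x => x) fun _ => aemeasurable_id).indepFun hij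
  rw [← lintegral_eval μ i hf, ← lintegral_eval μ j hg]
  exact ProbabilityTheory.lintegral_mul_eq_lintegral_mul_lintegral_of_indepFun''
    (hf.comp (measurable_pi_apply i)).aemeasurable (hg.comp (measurable_pi_apply j)).aemeasurable
    (hind.comp hf hg)

lemma lintegral_summandSize_le (μ : Measure (Vec d)) [IsProbabilityMeasure μ] (t : ℝ)
    {k l : Option (Fin N)} (hkl : l ≠ k) :
    ∫⁻ x, summandSize x k ^ (t - 1) * summandSize x l ∂(Measure.pi fun _ : Fin N => μ) ≤
      (1 + ∫⁻ x, ‖x‖ₑ ^ (t - 1) ∂μ) * (1 + ∫⁻ x, ‖x‖ₑ ^ (1 : ℝ) ∂μ) := by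
  have hm : ∀ s : ℝ, Measurable fun x : Vec d => ‖x‖ₑ ^ s := fun s => measurable_enorm.pow_const s
  cases k with
  | none =>
    cases l with
    | none => exact absurd rfl hkl
    | some j =>
      simp only [summandSize, ENNReal.one_rpow, one_mul]
      rw [lintegral_eval μ j measurable_enorm]
      simp only [ENNReal.rpow_one]
      exact le_mul_of_one_le_of_le le_self_add le_add_self
  | some i =>
    cases l with
    | none =>
      simp only [summandSize, mul_one]
      rw [lintegral_eval μ i (hm (t - 1))]
      exact le_mul_of_le_of_one_le le_add_self le_self_add
    | some j =>
      have hij : i ≠ j := fun h => hkl (by rw [h])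
      simp only [summandSize]
      rw [lintegral_eval_mul_eval μ hij (hm (t - 1)) measurable_enorm]
      simp only [ENNReal.rpow_one]
      gcongr <;> exact le_add_self

lemma lintegral_crossTerms_le (hC : ∀ i, Measurable (C i)) (hQ : Measurable Q) (ht : 1 ≤ t)
    (μ : Measure (Vec d)) [IsProbabilityMeasure μ] :
    ∫⁻ p : Ω × (Fin N → Vec d), crossTerms t (fun k => ‖summand C Q p.1 p.2 k‖ₑ)
        ∂(P.prod (Measure.pi fun _ : Fin N => μ)) ≤
      (∑ k, ∑ l, (∫⁻ ω, summandWeight C Q ω k ^ t ∂P + ∫⁻ ω, summandWeight C Q ω l ^ t ∂P)) *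
        ((1 + ∫⁻ x, ‖x‖ₑ ^ (t - 1) ∂μ) * (1 + ∫⁻ x, ‖x‖ₑ ^ (1 : ℝ) ∂μ)) := by
  have ht1 : 0 ≤ t - 1 := by linarith
  have hms : ∀ k, Measurable fun p : Ω × (Fin N → Vec d) => ‖summand C Q p.1 p.2 k‖ₑ := fun k =>
    (measurable_summand hC hQ k).enorm
  have hmterm : ∀ k l, Measurable fun p : Ω × (Fin N → Vec d) =>
      ‖summand C Q p.1 p.2 k‖ₑ ^ (t - 1) * ‖summand C Q p.1 p.2 l‖ₑ := fun k l =>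
    ((hms k).pow_const _).mul (hms l)
  have hw := measurable_summandWeight hC hQ
  simp only [crossTerms]
  rw [lintegral_finsetSum _ fun k _ => Finset.measurable_sum _ fun l _ => hmterm k l,
    Finset.sum_mul]
  refine Finset.sum_le_sum fun k _ => ?_
  rw [lintegral_finsetSum _ fun l _ => hmterm k l, Finset.sum_mul]
  refine (Finset.sum_le_sum fun l hl => ?_).trans
    (Finset.sum_le_sum_of_subset (Finset.subset_univ _))
  calc ∫⁻ p, ‖summand C Q p.1 p.2 k‖ₑ ^ (t - 1) * ‖summand C Q p.1 p.2 l‖ₑ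
        ∂(P.prod (Measure.pi fun _ : Fin N => μ))
      ≤ ∫⁻ p, (summandWeight C Q p.1 k ^ (t - 1) * summandWeight C Q p.1 l) *
          (summandSize p.2 k ^ (t - 1) * summandSize p.2 l)
          ∂(P.prod (Measure.pi fun _ : Fin N => μ)) := by
        refine lintegral_mono fun p => ?_
        refine (mul_le_mul' (ENNReal.rpow_le_rpow (enorm_summand_le p.1 p.2 k) ht1)
          (enorm_summand_le p.1 p.2 l)).trans_eq ?_
        rw [ENNReal.mul_rpow_of_nonneg _ _ ht1]
        ring
    _ = (∫⁻ ω, summandWeight C Q ω k ^ (t - 1) * summandWeight C Q ω l ∂P) *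
          ∫⁻ x, summandSize x k ^ (t - 1) * summandSize x l
            ∂(Measure.pi fun _ : Fin N => μ) :=
        lintegral_prod_mul
          (((hw k).pow_const _).mul (hw l)).aemeasurable
          (((measurable_summandSize k).pow_const _).mul (measurable_summandSize l)).aemeasurable
    _ ≤ _ := by
        gcongr
        · rw [← lintegral_add_left ((hw k).pow_const t)]
          exact lintegral_mono fun ω => rpow_sub_one_mul_le _ _ ht
        · exact lintegral_summandSize_le μ t (Finset.ne_of_mem_erase hl)

lemma lintegral_opNorm_rpow_ne_top (hN : N ≠ 0) (hC : ∀ i, Measurable (C i)) {s : ℝ}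
    (hCs : normMoment (weightLaw P C) s ≠ ∞) (i : Fin N) :
    ∫⁻ ω, opNorm (C i ω) ^ s ∂P ≠ ∞ := by
  refine ne_top_of_le_ne_top (ENNReal.mul_ne_top (ENNReal.natCast_ne_top N) hCs) ?_
  rw [normMoment, lintegral_weightLaw hN hC (measurable_opNorm.pow_const s)]
  exact Finset.single_le_sum (f := fun i => ∫⁻ ω, opNorm (C i ω) ^ s ∂P)
    (fun _ _ => zero_le) (Finset.mem_univ i)

variable [IsProbabilityMeasure P]

/-- One step of the smoothing transform decreases the integral of `lyapunov` by the `t`-th moment,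
up to the contribution of `Q` and of the mixed terms. -/
lemma lintegral_lyapunov_smoothing_add_le (hN : N ≠ 0) (hC : ∀ i, Measurable (C i))
    (hQ : Measurable Q) (μ : Measure (Vec d)) [IsProbabilityMeasure μ]
    {Z : Ω × (Fin N → Vec d) → ℝ≥0∞}
    (hle : ∀ p : Ω × (Fin N → Vec d),
      lyapunov N (weightLaw P C) t (∑ k, summand C Q p.1 p.2 k) ≤
        ∑ k, lyapunov N (weightLaw P C) t (summand C Q p.1 p.2 k) + Z p) :
    ∫⁻ x, lyapunov N (weightLaw P C) t x ∂(smoothing P C Q μ) + ∫⁻ x, ‖x‖ₑ ^ t ∂μ ≤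
      ∫⁻ x, lyapunov N (weightLaw P C) t x ∂μ +
        (∫⁻ ω, lyapunov N (weightLaw P C) t (Q ω) ∂P +
          ∫⁻ p, Z p ∂(P.prod (Measure.pi fun _ : Fin N => μ))) := by
  have := isProbabilityMeasure_weightLaw (P := P) hN hC
  set V := lyapunov N (weightLaw P C) t
  have hV : Measurable V := measurable_lyapunov
  have hmV : ∀ k, Measurable fun p : Ω × (Fin N → Vec d) => V (summand C Q p.1 p.2 k) := fun k =>
    hV.comp (measurable_summand hC hQ k)
  have hact : Measurable fun p : Mat d × Vec d => V (act p.1 p.2) := hV.comp measurable_act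
  have hsome : ∀ i, ∫⁻ p, V (summand C Q p.1 p.2 (some i))
      ∂(P.prod (Measure.pi fun _ : Fin N => μ)) = ∫⁻ ω, ∫⁻ x, V (act (C i ω) x) ∂μ ∂P := fun i => by
    rw [lintegral_prod _ (hmV (some i)).aemeasurable]
    refine lintegral_congr fun ω => ?_
    exact lintegral_eval μ i (f := fun x => V (act (C i ω) x))
      (hV.comp (measurable_act' measurable_const measurable_id))
  have hnone : ∫⁻ p, V (summand C Q p.1 p.2 none)
      ∂(P.prod (Measure.pi fun _ : Fin N => μ)) = ∫⁻ ω, V (Q ω) ∂P := by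
    rw [lintegral_prod _ (hmV none).aemeasurable]
    simp [summand]
  have hsum : ∑ i, ∫⁻ ω, ∫⁻ x, V (act (C i ω) x) ∂μ ∂P =
      ∫⁻ x, N * ∫⁻ A, V (act A x) ∂(weightLaw P C) ∂μ := by
    rw [lintegral_const_mul' _ _ (ENNReal.natCast_ne_top N), lintegral_lintegral_swap
      (by exact (hact.comp measurable_swap).aemeasurable),
      lintegral_weightLaw hN hC hact.lintegral_prod_right']
  calc ∫⁻ x, V x ∂(smoothing P C Q μ) + ∫⁻ x, ‖x‖ₑ ^ t ∂μ
      = ∫⁻ p, V (∑ k, summand C Q p.1 p.2 k) ∂(P.prod (Measure.pi fun _ : Fin N => μ)) +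
          ∫⁻ x, ‖x‖ₑ ^ t ∂μ := by
        rw [smoothing, lintegral_map hV (measurable_smoothing_map hC hQ)]
        simp_rw [sum_summand]
    _ ≤ ∫⁻ p, ∑ k, V (summand C Q p.1 p.2 k) + Z p ∂(P.prod (Measure.pi fun _ : Fin N => μ)) +
          ∫⁻ x, ‖x‖ₑ ^ t ∂μ := by
        gcongr with p
        exact hle p
    _ = (∫⁻ x, ‖x‖ₑ ^ t ∂μ + ∫⁻ x, N * ∫⁻ A, V (act A x) ∂(weightLaw P C) ∂μ) +
          (∫⁻ ω, V (Q ω) ∂P + ∫⁻ p, Z p ∂(P.prod (Measure.pi fun _ : Fin N => μ))) := by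
        rw [lintegral_add_left (Finset.measurable_sum _ fun k _ => hmV k),
          lintegral_finsetSum _ fun k _ => hmV k, Fintype.sum_option, hnone]
        simp_rw [hsome]
        rw [hsum]
        ring
    _ = _ := by
        rw [← lintegral_add_left (measurable_enorm.pow_const t)]
        congr 1
        exact lintegral_congr fun x => (lyapunov_eq x).symm

/-- The moments of order `t` stay bounded along the iteration as soon as the mixed terms do. -/
lemma exists_iterate_moment_le (hN : N ≠ 0) (hC : ∀ i, Measurable (C i)) (hQ : Measurable Q)
    (ht : 0 < t)
    (hsum : ∑' n, (N : ℝ≥0∞) ^ n * normMoment (productLaw (weightLaw P C) n) t ≠ ∞)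
    (hQt : ∫⁻ ω, ‖Q ω‖ₑ ^ t ∂P < ∞) {μ₀ : Measure (Vec d)} [IsProbabilityMeasure μ₀]
    (hμ₀ : ∫⁻ x, ‖x‖ₑ ^ t ∂μ₀ < ∞) {Z : Ω × (Fin N → Vec d) → ℝ≥0∞}
    (hle : ∀ (p : Ω × (Fin N → Vec d)) (A : Mat d),
      ‖act A (∑ k, summand C Q p.1 p.2 k)‖ₑ ^ t ≤
        ∑ k, ‖act A (summand C Q p.1 p.2 k)‖ₑ ^ t + opNorm A ^ t * Z p) {z : ℝ≥0∞} (hz : z ≠ ∞)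
    (hZ : ∀ n, ∫⁻ p, Z p ∂(P.prod (Measure.pi fun _ : Fin N => (smoothing P C Q)^[n] μ₀)) ≤ z) :
    ∃ B : ℝ≥0∞, B ≠ ∞ ∧ ∀ n, ∫⁻ x, ‖x‖ₑ ^ t ∂((smoothing P C Q)^[n] μ₀) ≤ B := by
  have := isProbabilityMeasure_weightLaw (P := P) hN hC
  have hprob := isProbabilityMeasure_iterate (P := P) hC hQ μ₀
  set S := ∑' n, (N : ℝ≥0∞) ^ n * normMoment (productLaw (weightLaw P C) n) t
  have hVle : ∀ (μ : Measure (Vec d)), ∫⁻ x, lyapunov N (weightLaw P C) t x ∂μ ≤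
      S * ∫⁻ x, ‖x‖ₑ ^ t ∂μ := fun μ => by
    rw [← lintegral_const_mul _ (measurable_enorm.pow_const t)]
    exact lintegral_mono fun x => lyapunov_le ht.le x
  have hQV : ∫⁻ ω, lyapunov N (weightLaw P C) t (Q ω) ∂P ≤ S * ∫⁻ ω, ‖Q ω‖ₑ ^ t ∂P := by
    rw [← lintegral_const_mul _ (hQ.enorm.pow_const t)]
    exact lintegral_mono fun ω => lyapunov_le ht.le (Q ω)
  set c : ℝ≥0∞ := S * ∫⁻ ω, ‖Q ω‖ₑ ^ t ∂P + S * z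
  have hc : c ≠ ∞ := ENNReal.add_ne_top.2
    ⟨ENNReal.mul_ne_top hsum hQt.ne, ENNReal.mul_ne_top hsum hz⟩
  have h0 : ∫⁻ x, lyapunov N (weightLaw P C) t x ∂((smoothing P C Q)^[0] μ₀) ≠ ∞ :=
    ne_top_of_le_ne_top (ENNReal.mul_ne_top hsum hμ₀.ne) (hVle μ₀)
  have hyx : ∀ n, ∫⁻ x, ‖x‖ₑ ^ t ∂((smoothing P C Q)^[n] μ₀) ≤
      ∫⁻ x, lyapunov N (weightLaw P C) t x ∂((smoothing P C Q)^[n] μ₀) := fun n =>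
    lintegral_mono fun x => rpow_le_lyapunov x
  have hrec := le_max_of_recursion hsum hc (fun n => ?_) hyx (fun n => hVle _) h0
  · exact ⟨_, (max_lt h0.lt_top (ENNReal.add_ne_top.2 ⟨ENNReal.mul_ne_top hsum hc, hc⟩).lt_top).ne,
      fun n => (hyx n).trans (hrec n)⟩
  · rw [Function.iterate_succ_apply']
    refine (lintegral_lyapunov_smoothing_add_le hN hC hQ _
      (Z := fun p => S * Z p) fun p => lyapunov_sum_le (hle p)).trans ?_
    rw [lintegral_const_mul' _ _ hsum]
    exact add_le_add le_rfl (add_le_add hQV (mul_le_mul_right (hZ n) S))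

lemma exists_iterate_moment_le_of_le_one (hN : N ≠ 0) (hC : ∀ i, Measurable (C i))
    (hQ : Measurable Q) (h0 : 0 < t) (h1 : t ≤ 1)
    (hsum : ∑' n, (N : ℝ≥0∞) ^ n * normMoment (productLaw (weightLaw P C) n) t ≠ ∞)
    (hQt : ∫⁻ ω, ‖Q ω‖ₑ ^ t ∂P < ∞) {μ₀ : Measure (Vec d)} [IsProbabilityMeasure μ₀]
    (hμ₀ : ∫⁻ x, ‖x‖ₑ ^ t ∂μ₀ < ∞) :
    ∃ B : ℝ≥0∞, B ≠ ∞ ∧ ∀ n, ∫⁻ x, ‖x‖ₑ ^ t ∂((smoothing P C Q)^[n] μ₀) ≤ B :=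
  exists_iterate_moment_le hN hC hQ h0 hsum hQt hμ₀
    (fun p A => enorm_act_sum_rpow_le_of_le_one h0 h1 (summand C Q p.1 p.2) A)
    ENNReal.zero_ne_top fun n => by simp

lemma exists_iterate_moment_le_of_one_le (hN : N ≠ 0) (hC : ∀ i, Measurable (C i))
    (hQ : Measurable Q) (ht : 1 ≤ t)
    (hsum : ∑' n, (N : ℝ≥0∞) ^ n * normMoment (productLaw (weightLaw P C) n) t ≠ ∞)
    (hCt : normMoment (weightLaw P C) t ≠ ∞)
    (hQt : ∫⁻ ω, ‖Q ω‖ₑ ^ t ∂P < ∞) {μ₀ : Measure (Vec d)} [IsProbabilityMeasure μ₀]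
    (hμ₀ : ∫⁻ x, ‖x‖ₑ ^ t ∂μ₀ < ∞)
    (h1 : ∃ B : ℝ≥0∞, B ≠ ∞ ∧ ∀ n, ∫⁻ x, ‖x‖ₑ ^ (1 : ℝ) ∂((smoothing P C Q)^[n] μ₀) ≤ B)
    (h2 : ∃ B : ℝ≥0∞, B ≠ ∞ ∧ ∀ n, ∫⁻ x, ‖x‖ₑ ^ (t - 1) ∂((smoothing P C Q)^[n] μ₀) ≤ B) :
    ∃ B : ℝ≥0∞, B ≠ ∞ ∧ ∀ n, ∫⁻ x, ‖x‖ₑ ^ t ∂((smoothing P C Q)^[n] μ₀) ≤ B := by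
  obtain ⟨B₁, hB₁, h1⟩ := h1
  obtain ⟨B₂, hB₂, h2⟩ := h2
  have hprob := isProbabilityMeasure_iterate (P := P) hC hQ μ₀
  have hw : ∀ k, ∫⁻ ω, summandWeight C Q ω k ^ t ∂P ≠ ∞ := by
    intro k
    cases k with
    | none => exact hQt.ne
    | some i => exact lintegral_opNorm_rpow_ne_top hN hC hCt i
  set κ : ℝ≥0∞ := ENNReal.ofReal t * (Fintype.card (Option (Fin N)) : ℝ≥0∞) ^ (t - 1)
  have hκ : κ ≠ ∞ := ENNReal.mul_ne_top ENNReal.ofReal_ne_top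
    (ENNReal.rpow_ne_top_of_nonneg (by linarith) (ENNReal.natCast_ne_top _))
  set W := ∑ k, ∑ l,
    (∫⁻ ω, summandWeight C Q ω k ^ t ∂P + ∫⁻ ω, summandWeight C Q ω l ^ t ∂P)
  have hW : W ≠ ∞ := ENNReal.sum_ne_top.2 fun k _ => ENNReal.sum_ne_top.2 fun l _ =>
    ENNReal.add_ne_top.2 ⟨hw k, hw l⟩
  refine exists_iterate_moment_le hN hC hQ (by linarith) hsum hQt hμ₀
    (fun p A => enorm_act_sum_rpow_le ht (summand C Q p.1 p.2) A)
    (z := κ * (W * ((1 + B₂) * (1 + B₁)))) ?_ fun n => ?_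
  · exact ENNReal.mul_ne_top hκ (ENNReal.mul_ne_top hW (ENNReal.mul_ne_top
      (ENNReal.add_ne_top.2 ⟨ENNReal.one_ne_top, hB₂⟩)
      (ENNReal.add_ne_top.2 ⟨ENNReal.one_ne_top, hB₁⟩)))
  · rw [lintegral_const_mul' _ _ hκ]
    gcongr
    refine (lintegral_crossTerms_le hC hQ ht _).trans ?_
    gcongr
    · exact h2 n
    · exact h1 n

end Recursion

section Initial

variable {Ω : Type*} [MeasurableSpace Ω] {P : Measure Ω} [IsProbabilityMeasure P] {N d : ℕ}
  {C : Fin N → Ω → Mat d} {Q : Ω → Vec d}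

lemma smoothing_dirac (hC : ∀ i, Measurable (C i)) (hQ : Measurable Q) (r : Vec d) :
    smoothing P C Q (Measure.dirac r) = P.map fun ω => ∑ i, act (C i ω) r + Q ω := by
  have hpi : (Measure.pi fun _ : Fin N => Measure.dirac r) = Measure.dirac fun _ => r := by
    refine Measure.pi_eq fun S hS => ?_
    rw [Measure.dirac_apply' _ (MeasurableSet.univ_pi hS)]
    simp_rw [Measure.dirac_apply' _ (hS _)]
    by_cases h : ∀ i, r ∈ S i
    · simp [Set.indicator, h]
    · obtain ⟨i, hi⟩ := not_forall.1 h
      rw [Finset.prod_eq_zero (Finset.mem_univ i) (Set.indicator_of_notMem hi _)]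
      exact Set.indicator_of_notMem (fun hr => hi (Set.mem_univ_pi.1 hr i)) _
  rw [smoothing, hpi, Measure.prod_dirac,
    Measure.map_map (measurable_smoothing_map hC hQ) (by fun_prop)]
  rfl

lemma measurable_sum_act_add (hC : ∀ i, Measurable (C i)) (hQ : Measurable Q) (r : Vec d) :
    Measurable fun ω => ∑ i, act (C i ω) r + Q ω :=
  (Finset.measurable_sum _ fun i _ => measurable_act' (hC i) measurable_const).add hQ

lemma lintegral_rpow_smoothing_dirac_lt_top (hN : N ≠ 0) (hC : ∀ i, Measurable (C i))
    (hQ : Measurable Q) {s : ℝ} (hs : 0 < s) (hCs : normMoment (weightLaw P C) s ≠ ∞)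
    (hQs : ∫⁻ ω, ‖Q ω‖ₑ ^ s ∂P < ∞) (r : Vec d) :
    ∫⁻ x, ‖x‖ₑ ^ s ∂(smoothing P C Q (Measure.dirac r)) < ∞ := by
  have hpow : ∀ k, Measurable fun ω => ‖summand C Q ω (fun _ => r) k‖ₑ ^ s := fun k =>
    (((measurable_summand hC hQ k).comp (measurable_id.prodMk measurable_const)).enorm).pow_const s
  rw [smoothing_dirac hC hQ, lintegral_map (measurable_enorm.pow_const s)
    (measurable_sum_act_add hC hQ r)]
  have hsummand : ∀ k, ∫⁻ ω, ‖summand C Q ω (fun _ => r) k‖ₑ ^ s ∂P ≠ ∞ := by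
    intro k
    cases k with
    | none => exact hQs.ne
    | some i =>
      refine ne_top_of_le_ne_top (ENNReal.mul_ne_top (lintegral_opNorm_rpow_ne_top hN hC hCs i)
        (ENNReal.rpow_ne_top_of_nonneg hs.le (enorm_ne_top (x := r)))) ?_
      rw [← lintegral_mul_const' _ _ (ENNReal.rpow_ne_top_of_nonneg hs.le enorm_ne_top)]
      refine lintegral_mono fun ω => ?_
      rw [← ENNReal.mul_rpow_of_nonneg _ _ hs.le]
      exact ENNReal.rpow_le_rpow (enorm_act_le _ _) hs.le
  calc ∫⁻ ω, ‖∑ i, act (C i ω) r + Q ω‖ₑ ^ s ∂P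
      ≤ ∫⁻ ω, (Fintype.card (Option (Fin N)) : ℝ≥0∞) ^ s *
          ∑ k, ‖summand C Q ω (fun _ => r) k‖ₑ ^ s ∂P := by
        refine lintegral_mono fun ω => ?_
        rw [← sum_summand (Q := Q) ω fun _ => r]
        exact (ENNReal.rpow_le_rpow (enorm_sum_le _ _) hs.le).trans
          (sum_rpow_le_card_mul Finset.univ _ hs)
    _ < ∞ := by
        rw [lintegral_const_mul _ (Finset.measurable_sum _ fun k _ => hpow k),
          lintegral_finsetSum _ fun k _ => hpow k]
        exact (ENNReal.mul_ne_top (ENNReal.rpow_ne_top_of_nonneg hs.le (ENNReal.natCast_ne_top _))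
          (ENNReal.sum_ne_top.2 fun k _ => hsummand k)).lt_top

lemma integral_smoothing_dirac (hN : N ≠ 0) (hC : ∀ i, Measurable (C i)) (hQ : Measurable Q)
    {s : ℝ} (hs : 1 ≤ s) (hCs : normMoment (weightLaw P C) s ≠ ∞)
    (hQs : ∫⁻ ω, ‖Q ω‖ₑ ^ s ∂P < ∞) (r : Vec d) :
    ∫ x, x ∂(smoothing P C Q (Measure.dirac r)) =
      (N : ℝ) • ∫ A, act A r ∂(weightLaw P C) + ∫ ω, Q ω ∂P := by
  have hmact : Measurable fun A : Mat d => act A r := measurable_act' measurable_id measurable_const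
  have hact : ∀ i, Measurable fun ω => act (C i ω) r := fun i => hmact.comp (hC i)
  have hQi : Integrable Q P := by
    refine ⟨hQ.aestronglyMeasurable, ?_⟩
    have := lintegral_rpow_le_one_add (μ := P) (fun ω => ‖Q ω‖ₑ) zero_le_one hs
    simp only [ENNReal.rpow_one] at this
    exact this.trans_lt (ENNReal.add_lt_top.2 ⟨ENNReal.one_lt_top, hQs⟩)
  have hCi : ∀ i, Integrable (fun ω => act (C i ω) r) P := fun i => by
    refine ⟨(hact i).aestronglyMeasurable, ?_⟩
    have h1 := lintegral_rpow_le_one_add (μ := P) (fun ω => opNorm (C i ω)) zero_le_one hs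
    simp only [ENNReal.rpow_one] at h1
    have h2 : ∫⁻ ω, opNorm (C i ω) ∂P ≠ ∞ := ne_top_of_le_ne_top
      (ENNReal.add_ne_top.2 ⟨ENNReal.one_ne_top, lintegral_opNorm_rpow_ne_top hN hC hCs i⟩) h1
    refine lt_of_le_of_lt (lintegral_mono fun ω => enorm_act_le (C i ω) r) ?_
    rw [lintegral_mul_const' _ _ enorm_ne_top]
    exact (ENNReal.mul_ne_top h2 enorm_ne_top).lt_top
  have hmap : ∀ i, Integrable (fun A => act A r) (P.map (C i)) := fun i =>
    (integrable_map_measure hmact.aestronglyMeasurable (hC i).aemeasurable).2 (hCi i)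
  have hN0 : (N : ℝ) ≠ 0 := by exact_mod_cast hN
  rw [smoothing_dirac hC hQ, integral_map
    (measurable_sum_act_add hC hQ r).aemeasurable (by fun_prop),
    integral_add (integrable_finsetSum _ fun i _ => hCi i) hQi,
    integral_finsetSum _ fun i _ => hCi i, weightLaw, integral_smul_measure,
    integral_finsetSum_measure fun i _ => hmap i, ENNReal.toReal_inv, ENNReal.toReal_natCast,
    smul_smul, mul_inv_cancel₀ hN0, one_smul]
  congr 1
  refine Finset.sum_congr rfl fun i _ => ?_
  rw [integral_map (hC i).aemeasurable hmact.aestronglyMeasurable]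

end Initial

section Main

variable {Ω : Type*} [MeasurableSpace Ω] {P : Measure Ω} [IsProbabilityMeasure P] {N d : ℕ}
  {C : Fin N → Ω → Mat d} {Q : Ω → Vec d}

lemma exists_ofReal_between {a b : ℝ≥0∞} (h : a < b) :
    ∃ s : ℝ, a < ENNReal.ofReal s ∧ ENNReal.ofReal s < b := by
  obtain ⟨x, hx1, hx2⟩ := exists_between h
  exact ⟨x.toReal, by rwa [ENNReal.ofReal_toReal hx2.ne_top],
    by rwa [ENNReal.ofReal_toReal hx2.ne_top]⟩

lemma pos_of_lt_ofReal {a : ℝ≥0∞} {s : ℝ} (h : a < ENNReal.ofReal s) : 0 < s :=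
  ENNReal.ofReal_pos.1 (bot_le.trans_lt h)

lemma lt_of_ofReal_lt_ofReal {s t : ℝ} (h : ENNReal.ofReal s < ENNReal.ofReal t) : s < t :=
  (ENNReal.ofReal_lt_ofReal_iff (pos_of_lt_ofReal h)).1 h

/-- There is at most one admissible solution. -/
lemma IsAdmissibleSolution.unique (hN : N ≠ 0) (hC : ∀ i, Measurable (C i)) (hQ : Measurable Q)
    (hα : alphaExp N (weightLaw P C) < 2)
    (hm : ∃ s : ℝ, alphaExp N (weightLaw P C) < ENNReal.ofReal s ∧
      ENNReal.ofReal s < betaExp N (weightLaw P C) ∧ mFun N (weightLaw P C) s < 1)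
    {r : Vec d} {μ μ' : Measure (Vec d)} (h : IsAdmissibleSolution P C Q r μ)
    (h' : IsAdmissibleSolution P C Q r μ') : μ = μ' := by
  have := isProbabilityMeasure_weightLaw (P := P) hN hC
  obtain ⟨⟨hμ, hfix⟩, ⟨t, ht, hμt⟩, hmean⟩ := h
  obtain ⟨⟨hμ', hfix'⟩, ⟨t', ht', hμt'⟩, hmean'⟩ := h'
  have hαβ : alphaExp N (weightLaw P C) < betaExp N (weightLaw P C) := by
    obtain ⟨s, hs1, hs2, -⟩ := hm
    exact hs1.trans hs2
  obtain ⟨s, hs, hs'⟩ : ∃ s : ℝ, alphaExp N (weightLaw P C) < ENNReal.ofReal s ∧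
      ENNReal.ofReal s < min (min (betaExp N (weightLaw P C)) 2)
        (min (min (ENNReal.ofReal t) (ENNReal.ofReal t'))
          (if alphaExp N (weightLaw P C) < 1 then 1 else ∞)) := by
    refine exists_ofReal_between (lt_min (lt_min hαβ hα) (lt_min (lt_min ht ht') ?_))
    split_ifs with h1
    · exact h1
    · exact hα.trans (by simp)
  simp only [lt_min_iff] at hs'
  obtain ⟨⟨hsβ, hs2⟩, ⟨hst, hst'⟩, hs1⟩ := hs'
  have hs0 := pos_of_lt_ofReal hs
  have hs2' : s < 2 := lt_of_ofReal_lt_ofReal (by simpa using hs2)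
  have hs1' : 1 < s → 1 ≤ alphaExp N (weightLaw P C) := fun h1 => by
    by_contra hlt
    rw [if_pos (not_le.1 hlt), ENNReal.ofReal_lt_one] at hs1
    linarith
  have hfin : ∀ {κ : Measure (Vec d)} [IsProbabilityMeasure κ] {t : ℝ},
      ENNReal.ofReal s < ENNReal.ofReal t → ∫⁻ x, ‖x‖ₑ ^ t ∂κ < ∞ → ∫⁻ x, ‖x‖ₑ ^ s ∂κ < ∞ :=
    fun hst hκ => (lintegral_rpow_le_one_add _ hs0.le (lt_of_ofReal_lt_ofReal hst).le).trans_lt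
      (ENNReal.add_lt_top.2 ⟨ENNReal.one_lt_top, hκ⟩)
  obtain ⟨K, hK, hKu⟩ := exists_enorm_charFun_sub_dirac_le hs0 hs2'.le (hfin hst hμt)
    fun h1 => hmean (hs1' h1)
  obtain ⟨K', hK', hKu'⟩ := exists_enorm_charFun_sub_dirac_le hs0 hs2'.le (hfin hst' hμt')
    fun h1 => hmean' (hs1' h1)
  refine eq_of_isFixedPt hN hC hQ hfix hfix' hs0.le (tsum_moment_ne_top hN hm hs hsβ)
    (ENNReal.add_ne_top.2 ⟨hK, hK'⟩) fun u => ?_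
  calc ‖charFun μ u - charFun μ' u‖ₑ
      = ‖(charFun μ u - charFun (Measure.dirac r) u) -
          (charFun μ' u - charFun (Measure.dirac r) u)‖ₑ := by congr 1; ring
    _ ≤ K * ‖u‖ₑ ^ s + K' * ‖u‖ₑ ^ s := enorm_sub_le.trans (add_le_add (hKu u) (hKu' u))
    _ = _ := (add_mul _ _ _).symm

/-- There is an admissible solution; it is the limit in law of the iteration started at `r`, which
stays at bounded Fourier distance of some order `s > α` from the starting point. -/
lemma exists_isAdmissibleSolution (hN : N ≠ 0) (hC : ∀ i, Measurable (C i)) (hQ : Measurable Q)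
    (hα : alphaExp N (weightLaw P C) < 2)
    (hm : ∃ s : ℝ, alphaExp N (weightLaw P C) < ENNReal.ofReal s ∧
      ENNReal.ofReal s < betaExp N (weightLaw P C) ∧ mFun N (weightLaw P C) s < 1)
    {r : Vec d}
    (hr : 1 ≤ alphaExp N (weightLaw P C) →
      r = (N : ℝ) • ∫ A, act A r ∂(weightLaw P C) + ∫ ω, Q ω ∂P)
    (hQs : ∃ s : ℝ, alphaExp N (weightLaw P C) < ENNReal.ofReal s ∧ ∫⁻ ω, ‖Q ω‖ₑ ^ s ∂P < ∞) :
    ∃ μ : Measure (Vec d), IsAdmissibleSolution P C Q r μ ∧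
      (∀ u, Tendsto (fun n => charFun ((smoothing P C Q)^[n] (Measure.dirac r)) u) atTop
        (𝓝 (charFun μ u))) ∧
      ∃ s : ℝ, alphaExp N (weightLaw P C) < ENNReal.ofReal s ∧ ∃ L : ℝ≥0∞, L ≠ ∞ ∧
        ∀ n u, ‖charFun ((smoothing P C Q)^[n] (Measure.dirac r)) u -
          charFun (Measure.dirac r) u‖ₑ ≤ L * ‖u‖ₑ ^ s := by
  have := isProbabilityMeasure_weightLaw (P := P) hN hC
  obtain ⟨q, hq, hQq⟩ := hQs
  have hαβ : alphaExp N (weightLaw P C) < betaExp N (weightLaw P C) := by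
    obtain ⟨s, hs1, hs2, -⟩ := hm
    exact hs1.trans hs2
  obtain ⟨s, hs, hs'⟩ : ∃ s : ℝ, alphaExp N (weightLaw P C) < ENNReal.ofReal s ∧
      ENNReal.ofReal s < min (min (betaExp N (weightLaw P C)) 2)
        (min (ENNReal.ofReal q) (if alphaExp N (weightLaw P C) < 1 then 1 else ∞)) := by
    refine exists_ofReal_between (lt_min (lt_min hαβ hα) (lt_min hq ?_))
    split_ifs with h1
    · exact h1
    · exact hα.trans (by simp)
  simp only [lt_min_iff] at hs'
  obtain ⟨⟨hsβ, hs2⟩, hsq, hs1⟩ := hs'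
  have hs0 := pos_of_lt_ofReal hs
  have hs2' : s < 2 := lt_of_ofReal_lt_ofReal (by simpa using hs2)
  have hs1' : 1 < s → 1 ≤ alphaExp N (weightLaw P C) := fun h1 => by
    by_contra hlt
    rw [if_pos (not_le.1 hlt), ENNReal.ofReal_lt_one] at hs1
    linarith
  have hCs := normMoment_ne_top hs0.le (hsβ.trans_le betaExp_le_sInfty)
  have hQs : ∫⁻ ω, ‖Q ω‖ₑ ^ s ∂P < ∞ :=
    (lintegral_rpow_le_one_add _ hs0.le (lt_of_ofReal_lt_ofReal hsq).le).trans_lt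
      (ENNReal.add_lt_top.2 ⟨ENNReal.one_lt_top, hQq⟩)
  have := isProbabilityMeasure_smoothing (P := P) hC hQ (Measure.dirac r)
  have hmom := lintegral_rpow_smoothing_dirac_lt_top hN hC hQ hs0 hCs hQs r
  obtain ⟨K, hK, hKu⟩ := exists_enorm_charFun_sub_dirac_le hs0 hs2'.le hmom (m := r) fun h1 =>
    ⟨integrable_of_lintegral_rpow_lt_top h1.le hmom,
      (integral_smoothing_dirac hN hC hQ h1.le hCs hQs r).trans (hr (hs1' h1)).symm⟩
  obtain ⟨μ, hμ, hfix, hlim, L, hL, hLu⟩ := exists_isFixedPt hN hC hQ (Measure.dirac r) hs0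
    (tsum_moment_ne_top hN hm hs hsβ) hK fun u => by
      rw [enorm_sub_rev]
      exact hKu u
  obtain ⟨t, ht, hts⟩ := exists_ofReal_between hs
  have ht0 := pos_of_lt_ofReal ht
  have hts' := lt_of_ofReal_lt_ofReal hts
  obtain ⟨B, hB, hBμ⟩ := exists_lintegral_rpow_le r ht0 hts' hL
  have hμt : ∫⁻ x, ‖x‖ₑ ^ t ∂μ < ∞ := (hBμ μ fun u => (hLu u).1).trans_lt hB.lt_top
  refine ⟨μ, ⟨⟨hμ, hfix⟩, ⟨t, ht, hμt⟩, fun h1 => ?_⟩, hlim, s, hs, L, hL,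
    fun n u => (hLu u).2 n⟩
  have ht1 : 1 < t := ENNReal.one_lt_ofReal.1 (h1.trans_lt ht)
  exact integral_eq_of_enorm_charFun_sub_dirac_le (ht1.trans hts') ht1
    (hts'.trans hs2').le hμt hL fun u => (hLu u).1

/-- All moments of order below `β` stay bounded along the iteration started at a point. -/
lemma exists_iterate_dirac_moment_le (hN : N ≠ 0) (hC : ∀ i, Measurable (C i)) (hQ : Measurable Q)
    (hm : ∃ s : ℝ, alphaExp N (weightLaw P C) < ENNReal.ofReal s ∧
      ENNReal.ofReal s < betaExp N (weightLaw P C) ∧ mFun N (weightLaw P C) s < 1)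
    (hQt : ∀ t : ℝ, 0 < t → ENNReal.ofReal t < betaExp N (weightLaw P C) →
      ∫⁻ ω, ‖Q ω‖ₑ ^ t ∂P < ∞) {r : Vec d} {s : ℝ}
    (hs : alphaExp N (weightLaw P C) < ENNReal.ofReal s) {L : ℝ≥0∞} (hL : L ≠ ∞)
    (hLu : ∀ n u, ‖charFun ((smoothing P C Q)^[n] (Measure.dirac r)) u -
      charFun (Measure.dirac r) u‖ₑ ≤ L * ‖u‖ₑ ^ s) {t : ℝ}
    (hαt : alphaExp N (weightLaw P C) < ENNReal.ofReal t)
    (htβ : ENNReal.ofReal t < betaExp N (weightLaw P C)) :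
    ∃ B : ℝ≥0∞, B ≠ ∞ ∧
      ∀ n, ∫⁻ x, ‖x‖ₑ ^ t ∂((smoothing P C Q)^[n] (Measure.dirac r)) ≤ B := by
  have := isProbabilityMeasure_weightLaw (P := P) hN hC
  have hprob := isProbabilityMeasure_iterate (P := P) hC hQ (Measure.dirac r)
  have hδ : ∀ t : ℝ, 0 < t → ∫⁻ x : Vec d, ‖x‖ₑ ^ t ∂(Measure.dirac r) < ∞ := fun t ht => by
    rw [lintegral_dirac' _ (measurable_enorm.pow_const t)]
    exact (ENNReal.rpow_ne_top_of_nonneg ht.le enorm_ne_top).lt_top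
  have hbase : ∀ t : ℝ, 0 < t → t < s → ∃ B : ℝ≥0∞, B ≠ ∞ ∧
      ∀ n, ∫⁻ x, ‖x‖ₑ ^ t ∂((smoothing P C Q)^[n] (Measure.dirac r)) ≤ B := fun t ht hts => by
    obtain ⟨B, hB, hBμ⟩ := exists_lintegral_rpow_le r ht hts hL
    exact ⟨B, hB, fun n => hBμ _ (hLu n)⟩
  have key : ∀ (k : ℕ) (t : ℝ), alphaExp N (weightLaw P C) < ENNReal.ofReal t →
      ENNReal.ofReal t < betaExp N (weightLaw P C) → t ≤ k + 1 → ∃ B : ℝ≥0∞, B ≠ ∞ ∧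
        ∀ n, ∫⁻ x, ‖x‖ₑ ^ t ∂((smoothing P C Q)^[n] (Measure.dirac r)) ≤ B := by
    intro k
    induction k with
    | zero =>
      intro t hαt htβ htk
      have ht0 := pos_of_lt_ofReal hαt
      exact exists_iterate_moment_le_of_le_one hN hC hQ ht0 (by simpa using htk)
        (tsum_moment_ne_top hN hm hαt htβ) (hQt t ht0 htβ) (hδ t ht0)
    | succ k ih =>
      intro t hαt htβ htk
      push_cast at htk
      have ht0 := pos_of_lt_ofReal hαt
      rcases le_or_gt t 1 with ht1 | ht1
      · exact ih t hαt htβ (by linarith [(Nat.cast_nonneg k : (0 : ℝ) ≤ k)])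
      have hone : ∃ B : ℝ≥0∞, B ≠ ∞ ∧
          ∀ n, ∫⁻ x, ‖x‖ₑ ^ (1 : ℝ) ∂((smoothing P C Q)^[n] (Measure.dirac r)) ≤ B := by
        rcases lt_or_ge (alphaExp N (weightLaw P C)) 1 with hα1 | hα1
        · refine ih 1 (by simpa using hα1) (lt_of_le_of_lt ?_ htβ) (by simp)
          exact ENNReal.ofReal_le_ofReal ht1.le
        · exact hbase 1 one_pos (ENNReal.one_lt_ofReal.1 (hα1.trans_lt hs))
      refine exists_iterate_moment_le_of_one_le hN hC hQ ht1.le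
        (tsum_moment_ne_top hN hm hαt htβ)
        (normMoment_ne_top ht0.le (htβ.trans_le betaExp_le_sInfty)) (hQt t ht0 htβ) (hδ t ht0)
        hone ?_
      rcases le_or_gt (t - 1) 1 with ht2 | ht2
      · obtain ⟨B, hB, hBn⟩ := hone
        exact ⟨1 + B, ENNReal.add_ne_top.2 ⟨ENNReal.one_ne_top, hB⟩, fun n =>
          (lintegral_rpow_le_one_add _ (by linarith) ht2).trans (by gcongr; exact hBn n)⟩
      rcases lt_or_ge (alphaExp N (weightLaw P C)) (ENNReal.ofReal (t - 1)) with hαt1 | hαt1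
      · exact ih (t - 1) hαt1 (lt_of_le_of_lt (ENNReal.ofReal_le_ofReal (by linarith)) htβ)
          (by linarith)
      · exact hbase (t - 1) (by linarith) (lt_of_ofReal_lt_ofReal (hαt1.trans_lt hs))
  obtain ⟨k, hk⟩ := exists_nat_ge t
  exact key k t hαt htβ (by linarith)

end Main

end SmoothingTransform

open SmoothingTransform
theorem proposition2p2 {Ω : Type*} [MeasurableSpace Ω] (P : Measure Ω) [IsProbabilityMeasure P]
    (N d : ℕ) (hN : 1 < N)
    (C : Fin N → Ω → Mat d) (Q : Ω → Vec d)
    (hC : ∀ i, Measurable (C i)) (hQ : Measurable Q)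
    (hα : 0 < alphaExp N (weightLaw P C))
    (hα' : alphaExp N (weightLaw P C) < min (sInfty (weightLaw P C)) 2)
    (hm : ∃ s : ℝ, alphaExp N (weightLaw P C) < ENNReal.ofReal s ∧
      ENNReal.ofReal s < betaExp N (weightLaw P C) ∧ mFun N (weightLaw P C) s < 1)
    (r : Vec d)
    (hr : 1 ≤ alphaExp N (weightLaw P C) →
      r = (N : ℝ) • ∫ A, act A r ∂(weightLaw P C) + ∫ ω, Q ω ∂P)
    (hQs : ∃ s : ℝ, alphaExp N (weightLaw P C) < ENNReal.ofReal s ∧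
      ENNReal.ofReal s < min (sInfty (weightLaw P C)) 2 ∧ ∫⁻ ω, ‖Q ω‖ₑ ^ s ∂P < ∞) :
    ∃ μ : Measure (Vec d),
      IsAdmissibleSolution P C Q r μ ∧
      (∀ μ' : Measure (Vec d), IsAdmissibleSolution P C Q r μ' → μ' = μ) ∧
      ((∀ t : ℝ, 0 < t →
          ENNReal.ofReal t ≤ min (sInfty (weightLaw P C)) (betaExp N (weightLaw P C)) →
          ∫⁻ ω, ‖Q ω‖ₑ ^ t ∂P < ∞) →
        ∀ t : ℝ, 0 < t →
          ENNReal.ofReal t < min (sInfty (weightLaw P C)) (betaExp N (weightLaw P C)) →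
          ∫⁻ x, ‖x‖ₑ ^ t ∂μ < ∞) := by
  have hN0 : N ≠ 0 := by omega
  have hα2 := hα'.trans_le (min_le_right _ _)
  obtain ⟨μ, hμ, hlim, s, hs, L, hL, hLu⟩ := exists_isAdmissibleSolution hN0 hC hQ hα2 hm hr
    (hQs.imp fun s h => ⟨h.1, h.2.2⟩)
  refine ⟨μ, hμ, fun μ' hμ' => hμ'.unique hN0 hC hQ hα2 hm hμ, fun hQt t ht htβ => ?_⟩
  have := hμ.1.1
  have hprob := isProbabilityMeasure_iterate (P := P) hC hQ (Measure.dirac r)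
  have hαβ : alphaExp N (weightLaw P C) < betaExp N (weightLaw P C) := by
    obtain ⟨s, hs1, hs2, -⟩ := hm
    exact hs1.trans hs2
  obtain ⟨t', ht', ht'β⟩ := exists_ofReal_between (max_lt hαβ (htβ.trans_le (min_le_right _ _)))
  obtain ⟨hαt', htt'⟩ := max_lt_iff.1 ht'
  obtain ⟨B, hB, hBn⟩ := exists_iterate_dirac_moment_le hN0 hC hQ hm
    (fun q hq hqβ => hQt q hq (le_min (hqβ.le.trans betaExp_le_sInfty) hqβ.le)) hs hL hLu hαt' ht'β
  have hμt' := lintegral_rpow_le_of_tendsto_charFun hlim (pos_of_lt_ofReal hαt') hBn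
  exact (lintegral_rpow_le_one_add _ ht.le (lt_of_ofReal_lt_ofReal htt').le).trans_lt
    (ENNReal.add_lt_top.2 ⟨ENNReal.one_lt_top, hμt'.trans_lt hB.lt_top⟩)
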